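/- Let $k\ge 1$ be a fixed integer, and for $n\ge 1$ let $d_k(n)$ denote the number of ordered $k$-tuples of positive integers whose product is $n$ (so $d_1(n)=1$ for all $n$). Assume that for every $\varepsilon>0$ there is a constant $C=C(\varepsilon,k)$ such that $$\int_0^T\bigl|\zeta(\tfrac12+it)\bigr|^k\,dt\le C\,T^{1+\varepsilon}\qquad\text{for all real } T\ge 1,$$ where $\zeta$ is the Riemann zeta-function. Then for every $\varepsilon>0$ there is a constant $C'=C'(\varepsilon,k)$ such that $$\Bigl|\sum_{N\le n\le 2N} d_k(n)\,n^{-1/6}\cos\bigl(3\pi n^{2/3}+\tfrac{\pi}{8}\bigr)\Bigr|\le C'\,N^{2/3+\varepsilon}\qquad\text{for all real } N\ge 1.$$ -/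

import Mathlib

/-- The `k`-fold divisor function `d_k(n)`: the number of ordered `k`-tuples of natural numbers
whose product is `n` (for `n ≥ 1`; the value at `n = 0` is `0`). -/
def kFoldDivisor (k n : ℕ) : ℕ := (Nat.finMulAntidiag k n).card

/-- The moment bound `∫₀ᵀ |ζ(1/2 + it)|^k dt ≪_{ε,k} T^{1+ε}`, for every `ε > 0`. -/
def ZetaMomentBound (k : ℕ) : Prop :=
  ∀ ε : ℝ, 0 < ε → ∃ C : ℝ, ∀ T : ℝ, 1 ≤ T →
    ∫ t in (0 : ℝ)..T, ‖riemannZeta (1 / 2 + Complex.I * (t : ℂ))‖ ^ k ≤ C * T ^ (1 + ε)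

/-!
Write `d_k(n) n^{-1/6} e^{i(3π n^{2/3} + π/8)}` as a smooth function `g` of `u = log n`. The sharp
range `N ≤ n ≤ 2N` is realised without error by a cutoff that is smooth on the scale of the gaps
between integers (`logCutoff`, `logWeight`). With `L g(s) = ∫ e^{su} g(u) du`, Laplace inversion and
the Dirichlet series of `d_k` give `2π ∑ d_k(n) g(log n) = ∫ ζ(7/6+it)^k L g(7/6+it) dt`
(`hasSum_kFoldDivisor_mul`).

The part `|t| ≥ 1` of the contour is moved to the critical line by Cauchy's theorem on two
rectangles, and the part `|t| ≤ 1` stays where it is, so that no residue at `s = 1` arises. The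
horizontal sides at height `±T` disappear as `T → ∞` because `L g` decays faster than any power and
`ζ(s) = O(|s|)` for `Re s ≥ 1/2` (`norm_riemannZeta_le`). The outcome is
`exists_norm_integral_zeta_pow_mul_bilateralLaplace_le`.

Everything then rests on the size of `L g`. Its phase `ψ(u) = 3π e^{2u/3} + tu` satisfies
`ψ'' ≫ N^{2/3}` for every `t`, so van der Corput's second derivative test gives
`L g(σ+it) ≪ N^{σ-1/6} N^{-1/3}`, which is `O(N^{2/3})` for `σ ≤ 7/6` and `O(1)` on the critical
line. There the range `|t| ≪ N^{2/3}` contributes `∫ |ζ|^k dt ≪ N^{2/3+ε}` by the moment bound. For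
`|t| ≫ N^{2/3}` there is no stationary point, and the first derivative test gives
`L g(1/2+it) ≪ N^{1/3}/|t|`; together with the crude bound `N^4/t^2` this makes the tail
convergent and of smaller order. The three bounds are merged into
`L g(1/2+it) ≪ N^{2/3+4η} |t|^{-1-η}` (`exists_norm_bilateralLaplace_logWeight_bounds`), and
`∫_1^∞ |ζ(1/2+it)|^k t^{-1-η} dt` is finite (`exists_integral_zeta_pow_mul_rpow_le`).
-/

section

open MeasureTheory Set Filter Topology Asymptotics
open scoped ContDiff

/-! ### The Dirichlet series of `d_k` and the growth of `ζ` -/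

/-- The recursion `d_{k+1} = 1 * d_k` (Dirichlet convolution): split off the first factor. -/
lemma kFoldDivisor_succ (k n : ℕ) :
    kFoldDivisor (k + 1) n = ∑ p ∈ n.divisorsAntidiagonal, kFoldDivisor k p.2 := by
  unfold kFoldDivisor
  rw [Finset.card_eq_sum_card_fiberwise (f := fun v => (v 0, ∏ i : Fin k, v i.succ))
    (t := n.divisorsAntidiagonal)]
  · refine Finset.sum_congr rfl fun p hp => ?_
    obtain ⟨hp1, hp2⟩ := Nat.mem_divisorsAntidiagonal.mp hp
    refine Finset.card_nbij' (fun v => Fin.tail v) (fun v => Fin.cons p.1 v) ?_ ?_ ?_ ?_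
    · intro v hv
      simp only [Finset.coe_filter, Set.mem_ofPred_eq, Nat.mem_finMulAntidiag] at hv
      simp only [Finset.mem_coe, Nat.mem_finMulAntidiag]
      refine ⟨?_, fun h0 => hp2 (by rw [← hp1, h0, mul_zero])⟩
      rw [← hv.2]; rfl
    · intro v hv
      simp only [Finset.mem_coe, Nat.mem_finMulAntidiag] at hv
      simp only [Finset.coe_filter, Set.mem_ofPred_eq, Nat.mem_finMulAntidiag]
      rw [Fin.prod_univ_succ]
      simp only [Fin.cons_zero, Fin.cons_succ, hv.1]
      exact ⟨⟨hp1, hp2⟩, trivial⟩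
    · intro v hv
      simp only [Finset.coe_filter, Set.mem_ofPred_eq] at hv
      rw [← hv.2]
      exact Fin.cons_self_tail v
    · intro v _
      simp
  · intro v hv
    simp only [Finset.mem_coe, Nat.mem_finMulAntidiag] at hv
    simp only [Finset.mem_coe, Nat.mem_divisorsAntidiagonal]
    rw [← Fin.prod_univ_succ]
    exact hv

/-- The Dirichlet series of `d_k` is `ζ ^ k`. -/
lemma LSeriesHasSum_kFoldDivisor (k : ℕ) {s : ℂ} (hs : 1 < s.re) :
    LSeriesHasSum (fun n => (kFoldDivisor k n : ℂ)) s (riemannZeta s ^ k) := by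
  induction k with
  | zero =>
    have h0 : (fun n => (kFoldDivisor 0 n : ℂ)) = LSeries.delta := by
      funext n
      rcases eq_or_ne n 1 with rfl | hn
      · simp [kFoldDivisor, Nat.finMulAntidiag_one, LSeries.delta]
      · simp [kFoldDivisor, Nat.finMulAntidiag_zero_left hn, LSeries.delta, hn]
    rw [h0, pow_zero, LSeriesHasSum]
    have : LSeries.term LSeries.delta s = fun n => if n = 1 then (1 : ℂ) else 0 := by
      funext n; exact LSeries.term_delta s n
    rw [this]
    exact hasSum_ite_eq 1 (1 : ℂ)
  | succ k ih =>
    have h1 : LSeriesHasSum 1 s (riemannZeta s) := by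
      rw [← LSeries_one_eq_riemannZeta hs]
      exact (LSeriesSummable_one_iff.mpr hs).LSeriesHasSum
    have := LSeriesHasSum.convolution h1 ih
    rw [LSeries.convolution_def, ← pow_succ'] at this
    convert this using 2 with n
    rw [kFoldDivisor_succ]
    push_cast
    exact Finset.sum_congr rfl fun p _ => by simp

/-- The Dirichlet series of `d_k` with its terms written as `d_k(n) e^{-s log n}`. -/
lemma hasSum_kFoldDivisor_mul_exp (k : ℕ) {s : ℂ} (hs : 1 < s.re) :
    HasSum (fun n : ℕ => (kFoldDivisor k n : ℂ) * Complex.exp (-s * Real.log n)) (riemannZeta s ^ k) := by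
  have h := LSeriesHasSum_kFoldDivisor k hs
  rw [LSeriesHasSum] at h
  convert h using 1
  funext n
  rcases eq_or_ne n 0 with rfl | hn
  · simp [kFoldDivisor]
  · rw [LSeries.term_of_ne_zero hn, Complex.cpow_def_of_ne_zero (by exact_mod_cast hn), div_eq_mul_inv,
      ← Complex.exp_neg, ← Complex.natCast_log]
    congr 2; push_cast; ring

/-- The Mellin transform of the fractional part `{x}` on `(1, ∞)` is holomorphic on `Re s < 0`;
at `-s` it is `∫_1^∞ {x} x^{-s-1} dx`. -/
lemma differentiableAt_mellin_fract {s : ℂ} (hs : s.re < 0) :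
    DifferentiableAt ℂ (mellin ((Ioi (1 : ℝ)).indicator fun x => ((Int.fract x : ℝ) : ℂ))) s := by
  have hb : ∀ x : ℝ, ‖(Ioi (1 : ℝ)).indicator (fun x => ((Int.fract x : ℝ) : ℂ)) x‖ ≤ 1 := by
    intro x
    refine (norm_indicator_le_norm_self _ _).trans ?_
    rw [Complex.norm_real, Real.norm_of_nonneg (Int.fract_nonneg x)]
    exact (Int.fract_lt_one x).le
  refine mellin_differentiableAt_of_isBigO_rpow (a := 0) (b := s.re - 1) ?_ ?_ (by simpa) ?_
    (by linarith)
  · refine LocallyIntegrable.locallyIntegrableOn ?_ _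
    refine (locallyIntegrable_const (1 : ℝ)).mono ?_ ?_
    · exact ((Complex.measurable_ofReal.comp measurable_fract).indicator
        measurableSet_Ioi).aestronglyMeasurable
    · exact Eventually.of_forall fun x => by simpa using hb x
  · refine isBigO_of_le' (c := 1) _ fun x => ?_
    simpa using hb x
  · refine EventuallyEq.trans_isBigO (f₂ := fun _ => (0 : ℂ)) ?_ (isBigO_zero _ _)
    have : Iio (1 : ℝ) ∈ 𝓝[>] (0 : ℝ) := mem_nhdsWithin_of_mem_nhds (Iio_mem_nhds one_pos)
    filter_upwards [this] with x hx
    exact indicator_of_notMem (by simpa using (le_of_lt hx : x ≤ 1)) _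

lemma mellin_fract_eq (s : ℂ) :
    mellin ((Ioi (1 : ℝ)).indicator fun x => ((Int.fract x : ℝ) : ℂ)) (-s) =
      ∫ x in Ioi (1 : ℝ), ((Int.fract x : ℝ) : ℂ) * (x : ℂ) ^ (-(s + 1)) := by
  unfold mellin
  have : (fun t : ℝ => (t : ℂ) ^ (-s - 1) • (Ioi (1 : ℝ)).indicator (fun x => ((Int.fract x : ℝ) : ℂ)) t)
      = (Ioi (1 : ℝ)).indicator fun t => ((Int.fract t : ℝ) : ℂ) * (t : ℂ) ^ (-(s + 1)) := by
    funext t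
    by_cases ht : t ∈ Ioi (1 : ℝ)
    · simp only [indicator_of_mem ht, smul_eq_mul]
      rw [mul_comm, neg_add, sub_eq_add_neg]
    · simp only [indicator_of_notMem ht, smul_zero]
  rw [this, setIntegral_indicator measurableSet_Ioi, Ioi_inter_Ioi]
  simp

lemma norm_fract_mul_cpow_le {s : ℂ} {x : ℝ} (hx : 1 < x) :
    ‖((Int.fract x : ℝ) : ℂ) * (x : ℂ) ^ (-(s + 1))‖ ≤ x ^ (-(s.re + 1)) := by
  rw [norm_mul, Complex.norm_real, Real.norm_of_nonneg (Int.fract_nonneg x),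
    Complex.norm_cpow_eq_rpow_re_of_pos (by linarith)]
  simp only [Complex.neg_re, Complex.add_re, Complex.one_re]
  exact mul_le_of_le_one_left (Real.rpow_nonneg (by linarith) _) (Int.fract_lt_one x).le

lemma norm_mellin_fract_le {s : ℂ} (hs : 1 / 2 ≤ s.re) :
    ‖mellin ((Ioi (1 : ℝ)).indicator fun x => ((Int.fract x : ℝ) : ℂ)) (-s)‖ ≤ 2 := by
  rw [mellin_fract_eq]
  have hint : IntegrableOn (fun x : ℝ => x ^ (-(3 / 2) : ℝ)) (Ioi 1) :=
    integrableOn_Ioi_rpow_of_lt (by norm_num) one_pos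
  calc _ ≤ ∫ x in Ioi (1 : ℝ), x ^ (-(3 / 2) : ℝ) := by
        refine norm_integral_le_of_norm_le hint ?_
        refine (ae_restrict_iff' measurableSet_Ioi).mpr (Eventually.of_forall fun x hx => ?_)
        refine (norm_fract_mul_cpow_le hx).trans ?_
        exact Real.rpow_le_rpow_of_exponent_le (le_of_lt hx) (by linarith)
    _ = 2 := by
        rw [integral_Ioi_rpow_of_lt (by norm_num) one_pos]
        norm_num

lemma riemannZeta_eq_sub_mul_integral_fract_of_one_lt_re {s : ℂ} (hs : 1 < s.re) :
    riemannZeta s = s / (s - 1) -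
      s * mellin ((Ioi (1 : ℝ)).indicator fun x => ((Int.fract x : ℝ) : ℂ)) (-s) := by
  have h1 : riemannZeta s
      = s * ∫ t in Ioi (1 : ℝ), (∑ k ∈ Finset.Icc 1 ⌊t⌋₊, (1 : ℕ → ℂ) k) * (t : ℂ) ^ (-(s + 1)) := by
    rw [← LSeries_one_eq_riemannZeta hs]
    refine LSeries_eq_mul_integral' 1 zero_le_one hs (isBigO_of_le _ fun n => ?_)
    simp
  have hs0 : s - 1 ≠ 0 := fun h => by
    rw [sub_eq_zero.mp h] at hs; simp at hs
  have hint1 : IntegrableOn (fun t : ℝ => (t : ℂ) ^ (-s)) (Ioi 1) :=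
    integrableOn_Ioi_cpow_of_lt (by simpa using hs) one_pos
  have hint2 : IntegrableOn (fun x : ℝ => ((Int.fract x : ℝ) : ℂ) * (x : ℂ) ^ (-(s + 1))) (Ioi 1) := by
    have hi : IntegrableOn (fun x : ℝ => x ^ (-(s.re + 1))) (Ioi 1) :=
      integrableOn_Ioi_rpow_of_lt (by linarith) one_pos
    refine Integrable.mono' hi ?_ ?_
    · refine AEStronglyMeasurable.mul
        (Complex.measurable_ofReal.comp measurable_fract).aestronglyMeasurable ?_
      refine ContinuousOn.aestronglyMeasurable (fun x hx => ?_) measurableSet_Ioi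
      refine ContinuousAt.continuousWithinAt ?_
      refine (continuousAt_cpow_const (Or.inl ?_)).comp Complex.continuous_ofReal.continuousAt
      simpa using one_pos.trans hx
    · exact (ae_restrict_iff' measurableSet_Ioi).mpr
        (Eventually.of_forall fun x hx => norm_fract_mul_cpow_le hx)
  rw [h1, mellin_fract_eq]
  have h2 : ∫ t in Ioi (1 : ℝ), (∑ k ∈ Finset.Icc 1 ⌊t⌋₊, (1 : ℕ → ℂ) k) * (t : ℂ) ^ (-(s + 1))
      = (∫ t in Ioi (1 : ℝ), (t : ℂ) ^ (-s)) -
        ∫ x in Ioi (1 : ℝ), ((Int.fract x : ℝ) : ℂ) * (x : ℂ) ^ (-(s + 1)) := by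
    rw [← integral_sub hint1 hint2]
    refine setIntegral_congr_fun measurableSet_Ioi fun t ht => ?_
    have ht0 : (t : ℂ) ≠ 0 := by exact_mod_cast (one_pos.trans ht).ne'
    have hfl : ((⌊t⌋₊ : ℝ)) = t - Int.fract t := by
      rw [natCast_floor_eq_intCast_floor (one_pos.trans ht).le, Int.self_sub_fract]
    have : (∑ k ∈ Finset.Icc 1 ⌊t⌋₊, (1 : ℕ → ℂ) k) = (t : ℂ) - Int.fract t := by
      rw [← Complex.ofReal_sub, ← hfl]; simp
    have hpow : (t : ℂ) ^ (-s) = t * (t : ℂ) ^ (-(s + 1)) := by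
      rw [show -s = 1 + (-(s + 1)) by ring, Complex.cpow_add _ _ ht0, Complex.cpow_one]
    simp only [this, hpow]; ring
  rw [h2, integral_Ioi_cpow_of_lt (by simpa using hs) one_pos]
  have : -s + 1 ≠ 0 := fun h => hs0 (by linear_combination -h)
  simp only [Complex.ofReal_one, Complex.one_cpow]
  field_simp
  ring

/-- The continuation of `ζ` to `Re s > 0` by `ζ(s) = s/(s-1) - s ∫_1^∞ {x} x^{-s-1} dx`. -/
lemma riemannZeta_eq_sub_mul_integral_fract {s : ℂ} (hs : 0 < s.re) (hs1 : s ≠ 1) :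
    riemannZeta s = s / (s - 1) -
      s * mellin ((Ioi (1 : ℝ)).indicator fun x => ((Int.fract x : ℝ) : ℂ)) (-s) := by
  set m := mellin ((Ioi (1 : ℝ)).indicator fun x => ((Int.fract x : ℝ) : ℂ)) with hm
  have hopen : IsOpen {z : ℂ | 0 < z.re} := isOpen_lt continuous_const Complex.continuous_re
  -- both sides are multiplied by `s - 1` so that the identity theorem applies on a half-plane
  have key : EqOn riemannZeta₁ (fun z => z - (z - 1) * (z * m (-z))) {z : ℂ | 0 < z.re} := by
    refine AnalyticOnNhd.eqOn_of_preconnected_of_eventuallyEq (𝕜 := ℂ)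
      (z₀ := 2) ?_ ?_ (convex_halfSpace_re_gt 0).isPreconnected (by simp) ?_
    · exact differentiable_riemannZeta₁.differentiableOn.analyticOnNhd hopen
    · refine DifferentiableOn.analyticOnNhd (fun z hz => ?_) hopen
      have hmz : DifferentiableAt ℂ (fun z => m (-z)) z := by
        have := differentiableAt_mellin_fract (s := -z) (by simpa using hz)
        exact this.comp z differentiableAt_id.neg
      exact (differentiableAt_id.sub ((differentiableAt_id.sub_const 1).mul
        (differentiableAt_id.mul hmz))).differentiableWithinAt
    · have : {z : ℂ | 1 < z.re} ∈ 𝓝 (2 : ℂ) :=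
        (isOpen_lt continuous_const Complex.continuous_re).mem_nhds (by simp)
      filter_upwards [this] with z hz
      have hz1 : z ≠ 1 := fun h => by rw [h] at hz; simp at hz
      have h := riemannZeta_eq_inv_sub_mul hz1
      rw [riemannZeta_eq_sub_mul_integral_fract_of_one_lt_re hz] at h
      have hz0 : z - 1 ≠ 0 := sub_ne_zero.mpr hz1
      field_simp at h
      rw [← h]; ring
  have h := key hs
  have hs0 : s - 1 ≠ 0 := sub_ne_zero.mpr hs1
  rw [riemannZeta_eq_inv_sub_mul hs1, h]
  field_simp

/-- A linear bound for `ζ` to the right of the critical line, away from the pole. -/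
lemma norm_riemannZeta_le {s : ℂ} (hs : 1 / 2 ≤ s.re) (him : 1 ≤ |s.im|) :
    ‖riemannZeta s‖ ≤ 3 * ‖s‖ := by
  have h1 : 1 ≤ ‖s - 1‖ := by
    refine him.trans ?_
    simpa using Complex.abs_im_le_norm (s - 1)
  have hs1 : s ≠ 1 := fun h => by rw [h] at him; simp at him; linarith
  rw [riemannZeta_eq_sub_mul_integral_fract (by linarith) hs1]
  refine (norm_sub_le _ _).trans ?_
  rw [norm_div, norm_mul]
  have h2 := norm_mellin_fract_le hs
  have h3 : ‖s‖ / ‖s - 1‖ ≤ ‖s‖ := div_le_self (norm_nonneg _) h1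
  nlinarith [norm_nonneg s]

/-! ### The two-sided Laplace transform -/

/-- The two-sided Laplace transform `∫ e^{su} g(u) du`, that is, the Mellin transform of
`g ∘ log`. -/
noncomputable def bilateralLaplace (g : ℝ → ℂ) (s : ℂ) : ℂ := ∫ u : ℝ, Complex.exp (s * u) * g u

section Laplace

variable {g : ℝ → ℂ}

lemma integrable_exp_mul (hg : Continuous g) (hc : HasCompactSupport g) (s : ℂ) :
    Integrable fun u : ℝ => Complex.exp (s * u) * g u :=
  Continuous.integrable_of_hasCompactSupport (by fun_prop) hc.mul_left

lemma bilateralLaplace_deriv (hg : ContDiff ℝ 1 g) (hc : HasCompactSupport g) (s : ℂ) :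
    bilateralLaplace (deriv g) s = -(s * bilateralLaplace g s) := by
  unfold bilateralLaplace
  have hcd : Continuous (deriv g) := hg.continuous_deriv le_rfl
  have hd : ∀ u : ℝ, HasDerivAt (fun u : ℝ => Complex.exp (s * u)) (Complex.exp (s * u) * s) u := by
    intro u
    have := ((hasDerivAt_id (u : ℂ)).const_mul s).cexp.comp_ofReal
    simpa using this
  have h := integral_mul_deriv_eq_deriv_mul_of_integrable (u := fun u : ℝ => Complex.exp (s * u))
    (v := g) (u' := fun u : ℝ => Complex.exp (s * u) * s) (v' := deriv g)
    (fun u _ => hd u)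
    (fun u _ => (hg.differentiable one_ne_zero u).hasDerivAt)
    (integrable_exp_mul hcd hc.deriv s)
    (by
      refine ((integrable_exp_mul hg.continuous hc s).const_mul s).congr
        (Eventually.of_forall fun u => ?_)
      simp only [Pi.mul_apply]; ring)
    (integrable_exp_mul hg.continuous hc s)
  rw [h, ← integral_const_mul]
  congr 2
  funext u; ring

lemma norm_bilateralLaplace_le (hg : Continuous g) (hc : HasCompactSupport g) {s : ℂ}
    (hs : |s.re| ≤ 2) : ‖bilateralLaplace g s‖ ≤ ∫ u : ℝ, Real.exp (2 * |u|) * ‖g u‖ := by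
  refine norm_integral_le_of_norm_le
    (Continuous.integrable_of_hasCompactSupport (by fun_prop) hc.norm.mul_left)
    (Eventually.of_forall fun u => ?_)
  rw [norm_mul, Complex.norm_exp]
  refine mul_le_mul_of_nonneg_right (Real.exp_le_exp.mpr ?_) (norm_nonneg _)
  simp only [Complex.mul_re, Complex.ofReal_re, Complex.ofReal_im, mul_zero, sub_zero]
  refine (le_abs_self _).trans ?_
  rw [abs_mul]
  exact mul_le_mul_of_nonneg_right hs (abs_nonneg _)

/-- The transform of a smooth compactly supported function decays faster than any power, uniformly
on a vertical strip. -/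
lemma exists_norm_pow_mul_bilateralLaplace_le (m : ℕ) (hg : ContDiff ℝ ∞ g)
    (hc : HasCompactSupport g) :
    ∃ C : ℝ, 0 ≤ C ∧ ∀ s : ℂ, |s.re| ≤ 2 → ‖s‖ ^ m * ‖bilateralLaplace g s‖ ≤ C := by
  induction m generalizing g with
  | zero =>
    refine ⟨∫ u : ℝ, Real.exp (2 * |u|) * ‖g u‖, integral_nonneg fun u => by positivity,
      fun s hs => ?_⟩
    rw [pow_zero, one_mul]
    exact norm_bilateralLaplace_le hg.continuous hc hs
  | succ m ih =>
    obtain ⟨C, hC0, hC⟩ := ih (g := deriv g) (contDiff_infty_iff_deriv.mp hg).2 hc.deriv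
    refine ⟨C, hC0, fun s hs => ?_⟩
    have := hC s hs
    rw [bilateralLaplace_deriv (hg.of_le (by exact_mod_cast le_top)) hc, norm_neg, norm_mul] at this
    rwa [pow_succ, mul_assoc]

lemma differentiable_bilateralLaplace (hg : Continuous g) (hc : HasCompactSupport g) :
    Differentiable ℂ (bilateralLaplace g) := by
  intro s
  refine (hasDerivAt_integral_of_dominated_loc_of_deriv_le
    (F := fun (z : ℂ) (u : ℝ) => Complex.exp (z * u) * g u)
    (F' := fun (z : ℂ) (u : ℝ) => Complex.exp (z * u) * u * g u)
    (bound := fun u : ℝ => Real.exp ((‖s‖ + 1) * |u|) * |u| * ‖g u‖)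
    (Metric.ball_mem_nhds s one_pos) ?_ (integrable_exp_mul hg hc s) ?_ ?_ ?_ ?_).2.differentiableAt
  · exact Eventually.of_forall fun z => (by fun_prop : Continuous _).aestronglyMeasurable
  · exact (by fun_prop : Continuous _).aestronglyMeasurable
  · refine Eventually.of_forall fun u z hz => ?_
    rw [norm_mul, norm_mul, Complex.norm_real, Real.norm_eq_abs, Complex.norm_exp]
    gcongr
    refine (Complex.re_le_norm _).trans ?_
    rw [norm_mul, Complex.norm_real, Real.norm_eq_abs]
    gcongr
    have := norm_sub_norm_le z s
    have h2 : ‖z - s‖ < 1 := by simpa [dist_eq_norm] using hz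
    linarith
  · exact Continuous.integrable_of_hasCompactSupport (by fun_prop) hc.norm.mul_left
  · refine Eventually.of_forall fun u z _ => ?_
    have := (((hasDerivAt_id z).mul_const (u : ℂ)).cexp).mul_const (g u)
    simpa using this

lemma integrable_bilateralLaplace_vertical (hg : ContDiff ℝ ∞ g) (hc : HasCompactSupport g) {σ : ℝ}
    (hσ : |σ| ≤ 2) : Integrable fun t : ℝ => bilateralLaplace g (σ + t * Complex.I) := by
  obtain ⟨C0, hC0, h0⟩ := exists_norm_pow_mul_bilateralLaplace_le 0 hg hc
  obtain ⟨C2, hC2, h2⟩ := exists_norm_pow_mul_bilateralLaplace_le 2 hg hc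
  refine Integrable.mono' (integrable_inv_one_add_sq.const_mul (C0 + C2)) ?_ ?_
  · refine Continuous.aestronglyMeasurable ?_
    exact (differentiable_bilateralLaplace hg.continuous hc).continuous.comp (by fun_prop)
  · refine Eventually.of_forall fun t => ?_
    have a0 := h0 (σ + t * Complex.I) (by simpa using hσ)
    have a2 := h2 (σ + t * Complex.I) (by simpa using hσ)
    have ht : t ^ 2 ≤ ‖(σ + t * Complex.I : ℂ)‖ ^ 2 := by
      rw [← sq_abs]
      gcongr
      simpa using Complex.abs_im_le_norm (σ + t * Complex.I : ℂ)
    rw [← div_eq_mul_inv, le_div_iff₀ (by positivity)]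
    rw [pow_zero, one_mul] at a0
    have := mul_le_mul_of_nonneg_right ht (norm_nonneg (bilateralLaplace g (σ + t * Complex.I)))
    linarith

/-- Inversion along the line `Re s = σ`. -/
lemma bilateralLaplace_inversion (hg : ContDiff ℝ ∞ g) (hc : HasCompactSupport g) {σ : ℝ}
    (hσ : |σ| ≤ 2) (v : ℝ) :
    ∫ t : ℝ, bilateralLaplace g (σ + t * Complex.I) * Complex.exp (-(σ + t * Complex.I) * v) =
      2 * Real.pi * g v := by
  set h : ℝ → ℂ := fun u => Complex.exp (σ * u) * g u with hh
  have hcont : Continuous h := by have := hg.continuous; fun_prop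
  have hF : ∀ ξ : ℝ, FourierTransform.fourier h ξ
      = bilateralLaplace g (σ + ((-(2 * Real.pi) * ξ : ℝ) : ℂ) * Complex.I) := by
    intro ξ
    rw [Real.fourier_eq', bilateralLaplace]
    congr 1
    funext u
    simp only [hh, smul_eq_mul, ← mul_assoc, ← Complex.exp_add]
    congr 2
    simp
    ring
  have hpi : (-(2 * Real.pi)) ≠ 0 := by simp [Real.pi_ne_zero]
  have hFint : Integrable (FourierTransform.fourier h) := by
    have := (integrable_bilateralLaplace_vertical hg hc hσ).comp_mul_left' hpi
    refine this.congr (Eventually.of_forall fun ξ => ?_)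
    exact (hF ξ).symm
  have hinv := (integrable_exp_mul hg.continuous hc σ).fourierInv_fourier_eq hFint
    (v := v) hcont.continuousAt
  rw [Real.fourierInv_eq'] at hinv
  set K : ℝ → ℂ := fun t => bilateralLaplace g (σ + t * Complex.I) *
    Complex.exp (-(t * Complex.I) * v) with hK
  have h1 : (∫ ξ : ℝ, K (-(2 * Real.pi) * ξ)) = h v := by
    refine Eq.trans ?_ hinv
    congr 1
    funext ξ
    simp only [hK]
    rw [← hh, hF, smul_eq_mul, mul_comm]
    congr 2
    simp
    ring
  rw [Measure.integral_comp_mul_left] at h1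
  have h2 : ∀ t : ℝ, bilateralLaplace g (σ + t * Complex.I) *
      Complex.exp (-(σ + t * Complex.I) * v) = Complex.exp (-(σ * v)) * K t := by
    intro t
    rw [hK, show -(σ + t * Complex.I) * v = -(σ * v : ℂ) + (-(t * Complex.I) * v) by ring,
      Complex.exp_add]
    ring
  simp_rw [h2]
  rw [integral_const_mul]
  have h3 : ∫ t, K t = 2 * Real.pi * h v := by
    rw [← h1, abs_inv, abs_neg, abs_of_pos (by positivity), Complex.real_smul]
    have : (Real.pi : ℂ) ≠ 0 := by exact_mod_cast Real.pi_ne_zero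
    push_cast
    field_simp
  rw [h3, hh, show Complex.exp (-(σ * v)) * (2 * Real.pi * (Complex.exp (σ * v) * g v))
    = 2 * Real.pi * (Complex.exp (-(σ * v)) * Complex.exp (σ * v)) * g v by ring,
    ← Complex.exp_add]
  simp

/-- The Mellin–Perron formula for a smooth compactly supported weight. -/
lemma hasSum_kFoldDivisor_mul (k : ℕ) (hg : ContDiff ℝ ∞ g) (hc : HasCompactSupport g) {σ : ℝ}
    (hσ1 : 1 < σ) (hσ : |σ| ≤ 2) :
    HasSum (fun n : ℕ => 2 * Real.pi * ((kFoldDivisor k n : ℂ) * g (Real.log n)))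
      (∫ t : ℝ, riemannZeta (σ + t * Complex.I) ^ k * bilateralLaplace g (σ + t * Complex.I)) := by
  have hint := integrable_bilateralLaplace_vertical hg hc hσ
  set F : ℕ → ℝ → ℂ := fun n t => (kFoldDivisor k n : ℂ) *
    Complex.exp (-(σ + t * Complex.I) * Real.log n) * bilateralLaplace g (σ + t * Complex.I) with hF
  have hnorm : ∀ n t, ‖F n t‖ = (kFoldDivisor k n : ℝ) * Real.exp (-σ * Real.log n) *
      ‖bilateralLaplace g (σ + t * Complex.I)‖ := by
    intro n t
    rw [hF, norm_mul, norm_mul, Complex.norm_natCast, Complex.norm_exp, Complex.re_mul_ofReal]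
    simp
  have h1 : HasSum (fun n => ∫ t, F n t) (∫ t, ∑' n, F n t) := by
    refine hasSum_integral_of_summable_integral_norm (fun n => ?_) ?_
    · refine (hint.norm.const_mul ((kFoldDivisor k n : ℝ) * Real.exp (-σ * Real.log n))).mono' ?_
        (Eventually.of_forall fun t => (hnorm n t).le)
      have := (differentiable_bilateralLaplace hg.continuous hc).continuous
      exact (by fun_prop : Continuous (F n)).aestronglyMeasurable
    · simp_rw [hnorm, integral_const_mul]
      refine Summable.mul_right _ ?_
      have := (hasSum_kFoldDivisor_mul_exp k (s := σ) (by simpa using hσ1)).summable.norm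
      refine this.congr fun n => ?_
      rw [norm_mul, Complex.norm_natCast, Complex.norm_exp, Complex.re_mul_ofReal]
      simp
  convert h1 using 1
  · funext n
    rw [mul_left_comm, ← bilateralLaplace_inversion hg hc hσ, ← integral_const_mul]
    congr 1
    funext t
    rw [hF]; ring
  · congr 1
    funext t
    rw [hF, tsum_mul_right]
    congr 1
    exact (hasSum_kFoldDivisor_mul_exp k (s := σ + t * Complex.I) (by simpa using hσ1)).tsum_eq.symm

end Laplace

/-! ### Van der Corput's derivative tests -/

section VanDerCorput

variable {ψ ψ' ψ'' : ℝ → ℝ} {a b μ : ℝ}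

lemma norm_integral_exp_I_le (hab : a ≤ b) (ψ : ℝ → ℝ) :
    ‖∫ u in a..b, Complex.exp (Complex.I * ψ u)‖ ≤ b - a := by
  have := intervalIntegral.norm_integral_le_of_norm_le_const (a := a) (b := b) (C := 1)
    (f := fun u => Complex.exp (Complex.I * ψ u)) fun u _ => by
      rw [mul_comm, Complex.norm_exp_ofReal_mul_I]
  rwa [one_mul, abs_of_nonneg (sub_nonneg.mpr hab)] at this

/-- First derivative test: a convex phase with derivative at least `μ > 0`. -/
lemma norm_integral_exp_I_le_of_deriv_ge (hab : a ≤ b) (h1 : ∀ u, HasDerivAt ψ (ψ' u) u)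
    (h2 : ∀ u, HasDerivAt ψ' (ψ'' u) u) (hc : Continuous ψ'') (hμ : 0 < μ)
    (hge : ∀ u ∈ Icc a b, μ ≤ ψ' u) (hconv : ∀ u ∈ Icc a b, 0 ≤ ψ'' u) :
    ‖∫ u in a..b, Complex.exp (Complex.I * ψ u)‖ ≤ 2 / μ := by
  have hψc : Continuous ψ := continuous_iff_continuousAt.mpr fun u => (h1 u).continuousAt
  have hψ'c : Continuous ψ' := continuous_iff_continuousAt.mpr fun u => (h2 u).continuousAt
  have hpos : ∀ u ∈ uIcc a b, 0 < ψ' u := fun u hu =>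
    hμ.trans_le (hge u (by rwa [uIcc_of_le hab] at hu))
  have hne : ∀ u ∈ uIcc a b, (ψ' u : ℂ) ≠ 0 := fun u hu => by exact_mod_cast (hpos u hu).ne'
  have hE : ∀ u, HasDerivAt (fun u => Complex.exp (Complex.I * ψ u))
      (Complex.exp (Complex.I * ψ u) * (Complex.I * ψ' u)) u := fun u =>
    ((h1 u).ofReal_comp.const_mul Complex.I).cexp
  have hinv : ∀ u ∈ uIcc a b, HasDerivAt (fun u => (ψ' u)⁻¹) (-(ψ'' u) / ψ' u ^ 2) u :=
    fun u hu => (h2 u).inv (hpos u hu).ne'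
  have hV : ∀ u ∈ uIcc a b, HasDerivAt (fun u => -Complex.I * (((ψ' u)⁻¹ : ℝ) : ℂ))
      (-Complex.I * ((-(ψ'' u) / ψ' u ^ 2 : ℝ) : ℂ)) u :=
    fun u hu => (hinv u hu).ofReal_comp.const_mul _
  have hd : ContinuousOn (fun u => -(ψ'' u) / ψ' u ^ 2) (uIcc a b) :=
    hc.neg.continuousOn.div (hψ'c.pow 2).continuousOn fun u hu => pow_ne_zero 2 (hpos u hu).ne'
  have hdC : ContinuousOn (fun u => -Complex.I * ((-(ψ'' u) / ψ' u ^ 2 : ℝ) : ℂ)) (uIcc a b) :=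
    continuousOn_const.mul (Complex.continuous_ofReal.comp_continuousOn hd)
  have hparts := intervalIntegral.integral_mul_deriv_eq_deriv_mul hV (fun u _ => hE u)
    hdC.intervalIntegrable (by fun_prop : Continuous _).continuousOn.intervalIntegrable
  have hcongr : ∫ u in a..b, Complex.exp (Complex.I * ψ u)
      = ∫ u in a..b, -Complex.I * (((ψ' u)⁻¹ : ℝ) : ℂ) *
        (Complex.exp (Complex.I * ψ u) * (Complex.I * ψ' u)) := by
    refine intervalIntegral.integral_congr fun u hu => ?_
    have := hne u hu
    push_cast
    field_simp
    linear_combination Complex.I_sq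
  have hnormE : ∀ u, ‖Complex.exp (Complex.I * ψ u)‖ = 1 := fun u => by
    rw [mul_comm, Complex.norm_exp_ofReal_mul_I]
  have hnormV : ∀ u ∈ uIcc a b, ‖-Complex.I * (((ψ' u)⁻¹ : ℝ) : ℂ)‖ = (ψ' u)⁻¹ := fun u hu => by
    rw [norm_mul, norm_neg, Complex.norm_I, one_mul, Complex.norm_real,
      Real.norm_of_nonneg (inv_nonneg.mpr (hpos u hu).le)]
  have hint : ‖∫ u in a..b, -Complex.I * ((-(ψ'' u) / ψ' u ^ 2 : ℝ) : ℂ) *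
      Complex.exp (Complex.I * ψ u)‖ ≤ (ψ' a)⁻¹ - (ψ' b)⁻¹ := by
    have hftc := intervalIntegral.integral_eq_sub_of_hasDerivAt hinv hd.intervalIntegrable
    have : (ψ' a)⁻¹ - (ψ' b)⁻¹ = ∫ u in a..b, -(-(ψ'' u) / ψ' u ^ 2) := by
      rw [intervalIntegral.integral_neg, hftc]; ring
    rw [this]
    refine intervalIntegral.norm_integral_le_of_norm_le hab (Eventually.of_forall fun u hu => ?_)
      hd.neg.intervalIntegrable
    rw [norm_mul, norm_mul, norm_neg, Complex.norm_I, one_mul, hnormE, mul_one, Complex.norm_real,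
      neg_div, norm_neg, neg_neg]
    exact (Real.norm_of_nonneg (div_nonneg (hconv u (Ioc_subset_Icc_self hu)) (sq_nonneg _))).le
  rw [hcongr, hparts]
  have hA : ‖-Complex.I * (((ψ' b)⁻¹ : ℝ) : ℂ) * Complex.exp (Complex.I * ψ b)‖ = (ψ' b)⁻¹ := by
    rw [norm_mul, hnormE, mul_one, hnormV b right_mem_uIcc]
  have hB : ‖-Complex.I * (((ψ' a)⁻¹ : ℝ) : ℂ) * Complex.exp (Complex.I * ψ a)‖ = (ψ' a)⁻¹ := by
    rw [norm_mul, hnormE, mul_one, hnormV a left_mem_uIcc]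
  refine (norm_sub_le _ _).trans ((add_le_add (norm_sub_le _ _) hint).trans ?_)
  rw [hA, hB]
  have : (ψ' a)⁻¹ ≤ μ⁻¹ := inv_anti₀ hμ (hge a (left_mem_Icc.mpr hab))
  rw [div_eq_mul_inv]
  linarith

lemma hasDerivAt_comp_neg {f : ℝ → ℝ} {f' u : ℝ} (h : HasDerivAt f f' (-u)) :
    HasDerivAt (fun v => f (-v)) (-f') u := by
  simpa [Function.comp_def] using h.scomp u (hasDerivAt_neg u)

/-- First derivative test for a convex phase with derivative at most `-μ < 0`, by reflection. -/
lemma norm_integral_exp_I_le_of_deriv_le (hab : a ≤ b) (h1 : ∀ u, HasDerivAt ψ (ψ' u) u)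
    (h2 : ∀ u, HasDerivAt ψ' (ψ'' u) u) (hc : Continuous ψ'') (hμ : 0 < μ)
    (hle : ∀ u ∈ Icc a b, ψ' u ≤ -μ) (hconv : ∀ u ∈ Icc a b, 0 ≤ ψ'' u) :
    ‖∫ u in a..b, Complex.exp (Complex.I * ψ u)‖ ≤ 2 / μ := by
  have hmem : ∀ u ∈ Icc (-b) (-a), -u ∈ Icc a b := fun u hu =>
    ⟨by linarith [hu.2], by linarith [hu.1]⟩
  have h := norm_integral_exp_I_le_of_deriv_ge (ψ := fun u => ψ (-u)) (ψ' := fun u => -ψ' (-u))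
    (ψ'' := fun u => ψ'' (-u)) (a := -b) (b := -a) (μ := μ) (by linarith)
    (fun u => hasDerivAt_comp_neg (h1 (-u)))
    (fun u => by simpa using (hasDerivAt_comp_neg (h2 (-u))).fun_neg)
    (by fun_prop) hμ (fun u hu => by linarith [hle _ (hmem u hu)])
    (fun u hu => hconv _ (hmem u hu))
  rwa [intervalIntegral.integral_comp_neg (fun u => Complex.exp (Complex.I * ψ u)), neg_neg,
    neg_neg] at h

lemma add_mul_sub_le_of_deriv_ge {lam : ℝ} (hab : a ≤ b) (h2 : ∀ u, HasDerivAt ψ' (ψ'' u) u)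
    (hconv : ∀ u ∈ Icc a b, lam ≤ ψ'' u) : ψ' a + lam * (b - a) ≤ ψ' b := by
  have := (convex_Icc a b).mul_sub_le_image_sub_of_le_deriv (f := ψ') (C := lam)
    (fun u _ => (h2 u).continuousAt.continuousWithinAt)
    (fun u _ => (h2 u).differentiableAt.differentiableWithinAt)
    (fun u hu => by rw [(h2 u).deriv]; exact hconv u (interior_subset hu))
    a (left_mem_Icc.mpr hab) b (right_mem_Icc.mpr hab) hab
  linarith

lemma norm_integral_exp_I_le_of_deriv_nonneg {lam : ℝ} (hab : a ≤ b)
    (h1 : ∀ u, HasDerivAt ψ (ψ' u) u)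
    (h2 : ∀ u, HasDerivAt ψ' (ψ'' u) u) (hc : Continuous ψ'') (hlam : 0 < lam)
    (ha : 0 ≤ ψ' a) (hconv : ∀ u ∈ Icc a b, lam ≤ ψ'' u) :
    ‖∫ u in a..b, Complex.exp (Complex.I * ψ u)‖ ≤ 3 / √lam := by
  have hs : 0 < √lam := Real.sqrt_pos.mpr hlam
  have hψc : Continuous ψ := continuous_iff_continuousAt.mpr fun u => (h1 u).continuousAt
  have h3 : 1 / √lam + 2 / √lam = 3 / √lam := by ring
  rcases le_total b (a + 1 / √lam) with h | h
  · refine (norm_integral_exp_I_le hab ψ).trans ?_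
    have : 0 ≤ 2 / √lam := by positivity
    linarith
  · set c := a + 1 / √lam with hcdef
    have hac : a ≤ c := by rw [hcdef]; linarith [(by positivity : 0 ≤ 1 / √lam)]
    have hψ'c : √lam ≤ ψ' c := by
      have := add_mul_sub_le_of_deriv_ge hac h2
        fun u hu => hconv u ⟨hu.1, hu.2.trans h⟩
      have h4 : lam * (c - a) = √lam := by
        rw [hcdef, add_sub_cancel_left]
        nth_rewrite 1 [← Real.mul_self_sqrt hlam.le]
        field_simp
      linarith
    have hint : ∀ x y, IntervalIntegrable (fun u => Complex.exp (Complex.I * ψ u)) volume x y :=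
      fun x y => (by fun_prop : Continuous _).intervalIntegrable x y
    rw [← intervalIntegral.integral_add_adjacent_intervals (hint a c) (hint c b), ← h3]
    refine (norm_add_le _ _).trans (add_le_add ?_ ?_)
    · exact (norm_integral_exp_I_le hac ψ).trans (by rw [hcdef]; linarith)
    · refine norm_integral_exp_I_le_of_deriv_ge h h1 h2 hc hs (fun u hu => ?_)
        (fun u hu => hlam.le.trans (hconv u ⟨hac.trans hu.1, hu.2⟩))
      have := add_mul_sub_le_of_deriv_ge hu.1 h2
        fun v hv => hconv v ⟨hac.trans hv.1, hv.2.trans hu.2⟩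
      nlinarith [hu.1]

/-- Second derivative test (van der Corput). -/
lemma norm_integral_exp_I_le_of_deriv2_ge {lam : ℝ} (hab : a ≤ b)
    (h1 : ∀ u, HasDerivAt ψ (ψ' u) u)
    (h2 : ∀ u, HasDerivAt ψ' (ψ'' u) u) (hc : Continuous ψ'') (hlam : 0 < lam)
    (hconv : ∀ u ∈ Icc a b, lam ≤ ψ'' u) :
    ‖∫ u in a..b, Complex.exp (Complex.I * ψ u)‖ ≤ 6 / √lam := by
  have hs : 0 < √lam := Real.sqrt_pos.mpr hlam
  have hψc : Continuous ψ := continuous_iff_continuousAt.mpr fun u => (h1 u).continuousAt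
  have hψ'c : Continuous ψ' := continuous_iff_continuousAt.mpr fun u => (h2 u).continuousAt
  have h36 : 3 / √lam + 3 / √lam = 6 / √lam := by ring
  have h3 : 0 ≤ 3 / √lam := by positivity
  -- the reflected phase `u ↦ ψ (-u)` covers the part where `ψ' ≤ 0`
  have hrefl : ∀ c, a ≤ c → c ≤ b → ψ' c ≤ 0 →
      ‖∫ u in a..c, Complex.exp (Complex.I * ψ u)‖ ≤ 3 / √lam := by
    intro c hac hcb hc0
    have h := norm_integral_exp_I_le_of_deriv_nonneg (ψ := fun u => ψ (-u))
      (ψ' := fun u => -ψ' (-u)) (ψ'' := fun u => ψ'' (-u)) (a := -c) (b := -a) (lam := lam)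
      (by linarith) (fun u => hasDerivAt_comp_neg (h1 (-u)))
      (fun u => by simpa using (hasDerivAt_comp_neg (h2 (-u))).fun_neg)
      (by fun_prop) hlam (by simpa using hc0)
      (fun u hu => hconv _ ⟨by linarith [hu.2], by linarith [hu.1]⟩)
    rwa [intervalIntegral.integral_comp_neg (fun u => Complex.exp (Complex.I * ψ u)), neg_neg,
      neg_neg] at h
  rcases le_or_gt 0 (ψ' a) with ha | ha
  · exact (norm_integral_exp_I_le_of_deriv_nonneg hab h1 h2 hc hlam ha hconv).trans (by linarith)
  rcases le_or_gt (ψ' b) 0 with hb | hb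
  · exact (hrefl b hab le_rfl hb).trans (by linarith)
  obtain ⟨c, hcm, hc0⟩ := intermediate_value_Icc hab hψ'c.continuousOn ⟨ha.le, hb.le⟩
  have hint : ∀ x y, IntervalIntegrable (fun u => Complex.exp (Complex.I * ψ u)) volume x y :=
    fun x y => (by fun_prop : Continuous _).intervalIntegrable x y
  rw [← intervalIntegral.integral_add_adjacent_intervals (hint a c) (hint c b), ← h36]
  refine (norm_add_le _ _).trans (add_le_add (hrefl c hcm.1 hcm.2 hc0.le) ?_)
  exact norm_integral_exp_I_le_of_deriv_nonneg hcm.2 h1 h2 hc hlam hc0.ge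
    fun u hu => hconv u ⟨hcm.1.trans hu.1, hu.2⟩

/-- Partial summation against an amplitude vanishing at the right end point. -/
lemma norm_integral_mul_le_of_forall_norm_integral_le {κ : ℝ → ℂ} {w w' : ℝ → ℝ} {B : ℝ}
    (hab : a ≤ b) (hκ : Continuous κ) (hw : ∀ u, HasDerivAt w (w' u) u) (hw' : Continuous w')
    (hb : w b = 0) (hB : ∀ c ∈ Icc a b, ‖∫ u in a..c, κ u‖ ≤ B) :
    ‖∫ u in a..b, (w u : ℂ) * κ u‖ ≤ B * ∫ u in a..b, |w' u| := by
  have hG : ∀ u, HasDerivAt (fun c => ∫ v in a..c, κ v) (κ u) u := fun u =>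
    (hκ.integral_hasStrictDerivAt a u).hasDerivAt
  have hparts := intervalIntegral.integral_mul_deriv_eq_deriv_mul (a := a) (b := b)
    (fun u _ => (hw u).ofReal_comp) (fun u _ => hG u)
    (by fun_prop : Continuous fun u => (w' u : ℂ)).continuousOn.intervalIntegrable
    hκ.continuousOn.intervalIntegrable
  rw [hparts, hb, ← intervalIntegral.integral_const_mul B]
  simp only [Complex.ofReal_zero, zero_mul, intervalIntegral.integral_same, mul_zero, sub_zero,
    zero_sub, norm_neg]
  refine intervalIntegral.norm_integral_le_of_norm_le hab (Eventually.of_forall fun u hu => ?_)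
    ((by fun_prop : Continuous fun u => B * |w' u|).intervalIntegrable a b)
  rw [norm_mul, Complex.norm_real, Real.norm_eq_abs, mul_comm]
  exact mul_le_mul_of_nonneg_right (hB u (Ioc_subset_Icc_self hu)) (abs_nonneg _)

end VanDerCorput

/-! ### Moving the contour -/

section Contour

lemma continuous_riemannZeta_vertical {σ : ℝ} (hσ : σ ≠ 1) :
    Continuous fun t : ℝ => riemannZeta (σ + t * Complex.I) := by
  refine continuous_iff_continuousAt.mpr fun t => ?_
  have hne : (σ + t * Complex.I : ℂ) ≠ 1 := fun h => hσ (by simpa using congrArg Complex.re h)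
  exact (differentiableAt_riemannZeta hne).continuousAt.comp
    (f := fun t : ℝ => (σ + t * Complex.I : ℂ)) (by fun_prop : Continuous _).continuousAt

/-- The moment bound makes `|ζ(1/2+it)|^k t^{-1-η}` integrable on `[1, ∞)`, by partial summation. -/
lemma exists_integral_zeta_pow_mul_rpow_le {k : ℕ} (h : ZetaMomentBound k) {η : ℝ} (hη : 0 < η) :
    ∃ K : ℝ, 0 ≤ K ∧ ∀ T : ℝ, 1 ≤ T →
      ∫ t in (1 : ℝ)..T, ‖riemannZeta ((1 / 2 : ℝ) + t * Complex.I)‖ ^ k * t ^ (-1 - η) ≤ K := by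
  obtain ⟨C, hC⟩ := h (η / 2) (by linarith)
  set φ : ℝ → ℝ := fun t => ‖riemannZeta ((1 / 2 : ℝ) + t * Complex.I)‖ ^ k with hφ
  have hφc : Continuous φ := (continuous_riemannZeta_vertical (by norm_num)).norm.pow k
  set M : ℝ → ℝ := fun T => ∫ t in (0 : ℝ)..T, φ t with hM
  have hMle : ∀ T, 1 ≤ T → M T ≤ C * T ^ (1 + η / 2) := by
    intro T hT
    refine le_of_eq_of_le ?_ (hC T hT)
    simp only [hM, hφ]
    congr 1
    funext t
    congr 3
    push_cast
    ring
  have hM0 : ∀ T, 0 ≤ T → 0 ≤ M T := fun T hT =>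
    intervalIntegral.integral_nonneg hT fun t _ => by positivity
  have hC0 : 0 ≤ C := by
    have := (hM0 1 zero_le_one).trans (hMle 1 le_rfl)
    simpa using this
  refine ⟨C + (1 + η) * (C * (2 / η)), by positivity, fun T hT => ?_⟩
  have hpos : ∀ t ∈ uIcc 1 T, 0 < t := fun t ht => by
    rw [uIcc_of_le hT] at ht; linarith [ht.1]
  have hMd : ∀ t, HasDerivAt M (φ t) t := fun t =>
    (hφc.integral_hasStrictDerivAt 0 t).hasDerivAt
  have hMc : Continuous M := continuous_iff_continuousAt.mpr fun t => (hMd t).continuousAt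
  have hrc : ∀ p : ℝ, ContinuousOn (fun t : ℝ => t ^ p) (uIcc 1 T) := fun p t ht =>
    (Real.continuousAt_rpow_const t p (Or.inl (hpos t ht).ne')).continuousWithinAt
  have hparts := intervalIntegral.integral_mul_deriv_eq_deriv_mul
    (u := fun t : ℝ => t ^ (-1 - η)) (u' := fun t : ℝ => (-1 - η) * t ^ (-1 - η - 1))
    (v := M) (v' := φ) (a := 1) (b := T)
    (fun t ht => Real.hasDerivAt_rpow_const (Or.inl (hpos t ht).ne')) (fun t _ => hMd t)
    (continuousOn_const.mul (hrc _)).intervalIntegrable (hφc.intervalIntegrable _ _)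
  have hcomm : ∫ t in (1 : ℝ)..T, φ t * t ^ (-1 - η) = ∫ t in (1 : ℝ)..T, t ^ (-1 - η) * φ t := by
    simp_rw [mul_comm]
  rw [hcomm, hparts]
  have hT0 : 0 < T := by linarith
  have hb : T ^ (-1 - η) * M T ≤ C := by
    calc T ^ (-1 - η) * M T ≤ T ^ (-1 - η) * (C * T ^ (1 + η / 2)) :=
          mul_le_mul_of_nonneg_left (hMle T hT) (by positivity)
      _ = C * T ^ (-(η / 2)) := by
          rw [mul_left_comm, ← Real.rpow_add hT0]; congr 2; ring
      _ ≤ C := mul_le_of_le_one_right hC0 (Real.rpow_le_one_of_one_le_of_nonpos hT (by linarith))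
  have hint : -∫ t in (1 : ℝ)..T, (-1 - η) * t ^ (-1 - η - 1) * M t
      ≤ (1 + η) * (C * (2 / η)) := by
    have h1 : -∫ t in (1 : ℝ)..T, (-1 - η) * t ^ (-1 - η - 1) * M t
        ≤ ∫ t in (1 : ℝ)..T, (1 + η) * (C * t ^ (-1 - η / 2)) := by
      rw [← intervalIntegral.integral_neg]
      refine intervalIntegral.integral_mono_on hT
        ((continuousOn_const.mul (hrc _)).mul hMc.continuousOn).neg.intervalIntegrable
        (continuousOn_const.mul (continuousOn_const.mul (hrc _))).intervalIntegrable ?_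
      intro t ht
      have ht0 : 0 < t := by linarith [ht.1]
      have : t ^ (-1 - η - 1) * M t ≤ C * t ^ (-1 - η / 2) := by
        calc t ^ (-1 - η - 1) * M t ≤ t ^ (-1 - η - 1) * (C * t ^ (1 + η / 2)) :=
              mul_le_mul_of_nonneg_left (hMle t ht.1) (by positivity)
          _ = C * t ^ (-1 - η / 2) := by
              rw [mul_left_comm, ← Real.rpow_add ht0]; congr 2; ring
      have := mul_le_mul_of_nonneg_left this (by linarith : 0 ≤ 1 + η)
      linarith
    refine h1.trans ?_
    rw [intervalIntegral.integral_const_mul, intervalIntegral.integral_const_mul]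
    gcongr
    have h0 : (0 : ℝ) ∉ uIcc 1 T := fun h => (hpos 0 h).ne rfl
    rw [integral_rpow (Or.inr ⟨by linarith, h0⟩), Real.one_rpow]
    have : T ^ (-1 - η / 2 + 1) ≥ 0 := by positivity
    rw [show -1 - η / 2 + 1 = -(η / 2) by ring] at this ⊢
    rw [div_neg, ← neg_div, show 2 / η = 1 / (η / 2) by field_simp]
    gcongr
    linarith
  have h1 : 0 ≤ (1 : ℝ) ^ (-1 - η) * M 1 := by
    rw [Real.one_rpow, one_mul]; exact hM0 1 zero_le_one
  linarith

/-- Cauchy's theorem on a rectangle, as a bound for the integral over its right side. -/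
lemma norm_integral_right_le_of_differentiableOn {Φ : ℂ → ℂ} {σ₀ σ₁ t₀ t₁ : ℝ} (hσ : σ₀ ≤ σ₁)
    (ht : t₀ ≤ t₁) (hΦ : ∀ s : ℂ, s.re ∈ Icc σ₀ σ₁ → s.im ∈ Icc t₀ t₁ → DifferentiableAt ℂ Φ s) :
    ‖∫ t in t₀..t₁, Φ (σ₁ + t * Complex.I)‖ ≤ ‖∫ t in t₀..t₁, Φ (σ₀ + t * Complex.I)‖ +
      ‖∫ x in σ₀..σ₁, Φ (x + t₀ * Complex.I)‖ + ‖∫ x in σ₀..σ₁, Φ (x + t₁ * Complex.I)‖ := by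
  have h := Complex.integral_boundary_rect_eq_zero_of_differentiableOn Φ ⟨σ₀, t₀⟩ ⟨σ₁, t₁⟩
    (fun s hs => by
      rw [Complex.mem_reProdIm, uIcc_of_le hσ, uIcc_of_le ht] at hs
      exact (hΦ s hs.1 hs.2).differentiableWithinAt)
  simp only [smul_eq_mul] at h
  set A := ∫ t in t₀..t₁, Φ (σ₁ + t * Complex.I)
  set B := ∫ t in t₀..t₁, Φ (σ₀ + t * Complex.I)
  set D := ∫ x in σ₀..σ₁, Φ (x + t₀ * Complex.I)
  set E := ∫ x in σ₀..σ₁, Φ (x + t₁ * Complex.I)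
  have hA : A = B + Complex.I * D + -(Complex.I * E) := by
    linear_combination (-Complex.I) * h + (A - B) * Complex.I_sq
  rw [hA]
  refine (norm_add₃_le).trans ?_
  simp

/-- Moving the integral of `ζ^k · L g` from `Re s = 7/6` to `Re s = 1/2` for `|Im s| ≥ 1`, and
leaving it where it is for `|Im s| ≤ 1`, avoids the pole of `ζ`. -/
lemma exists_norm_integral_zeta_pow_mul_bilateralLaplace_le {k : ℕ} (h : ZetaMomentBound k)
    {η : ℝ} (hη : 0 < η) :
    ∃ C : ℝ, 0 ≤ C ∧ ∀ (g : ℝ → ℂ) (M₀ M₁ : ℝ), ContDiff ℝ ∞ g → HasCompactSupport g →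
      (∀ s : ℂ, s.re ∈ Icc (1 / 2 : ℝ) (7 / 6) → |s.im| ≤ 1 → ‖bilateralLaplace g s‖ ≤ M₀) →
      (∀ t : ℝ, 1 ≤ |t| →
        ‖bilateralLaplace g ((1 / 2 : ℝ) + t * Complex.I)‖ ≤ M₁ * |t| ^ (-1 - η)) →
      ‖∫ t : ℝ, riemannZeta ((7 / 6 : ℝ) + t * Complex.I) ^ k *
        bilateralLaplace g ((7 / 6 : ℝ) + t * Complex.I)‖ ≤ C * (M₀ + M₁) := by
  obtain ⟨K, hK0, hK⟩ := exists_integral_zeta_pow_mul_rpow_le h hη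
  obtain ⟨Z, hZ⟩ := (isCompact_Icc (a := (-1 : ℝ)) (b := 1)).exists_bound_of_continuousOn
    ((continuous_riemannZeta_vertical (σ := 7 / 6) (by norm_num)).pow k).continuousOn
  have hZ0 : 0 ≤ Z := (norm_nonneg _).trans (hZ 0 (by simp))
  refine ⟨2 * K + 2 * 9 ^ k + 2 * Z, by positivity, fun g M₀ M₁ hg hc hM0 hM1 => ?_⟩
  set L := bilateralLaplace g with hL
  have hLd : Differentiable ℂ L := differentiable_bilateralLaplace hg.continuous hc
  set Φ : ℂ → ℂ := fun s => riemannZeta s ^ k * L s with hΦ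
  have hΦd : ∀ s : ℂ, 1 ≤ |s.im| → DifferentiableAt ℂ Φ s := by
    intro s hs
    have hs1 : s ≠ 1 := fun h => by rw [h] at hs; simp at hs; linarith
    exact ((differentiableAt_riemannZeta hs1).pow k).mul (hLd s)
  have hM0' : 0 ≤ M₀ := (norm_nonneg _).trans (hM0 (1 / 2 : ℝ) (by norm_num) (by simp))
  have hM1' : 0 ≤ M₁ := by
    have := (norm_nonneg _).trans (hM1 1 (by simp))
    simpa using this
  obtain ⟨D, hD0, hD⟩ := exists_norm_pow_mul_bilateralLaplace_le (k + 1) hg hc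
  -- horizontal segments at height `±1`
  have hlow : ∀ τ : ℝ, |τ| = 1 →
      ‖∫ x in (1 / 2 : ℝ)..(7 / 6), Φ (x + τ * Complex.I)‖ ≤ 9 ^ k * M₀ := by
    intro τ hτ
    refine (intervalIntegral.norm_integral_le_of_norm_le_const (C := 9 ^ k * M₀) ?_).trans ?_
    · intro x hx
      rw [uIoc_of_le (by norm_num)] at hx
      have hz : ‖riemannZeta (x + τ * Complex.I)‖ ≤ 9 := by
        refine (norm_riemannZeta_le (by simpa using hx.1.le) (by simp [hτ])).trans ?_
        have := Complex.norm_le_abs_re_add_abs_im (x + τ * Complex.I)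
        have hx0 : |x| ≤ 2 := abs_le.mpr ⟨by linarith [hx.1], by linarith [hx.2]⟩
        simp [hτ] at this
        linarith
      simp only [hΦ, norm_mul, norm_pow]
      gcongr
      exact hM0 _ (by simpa using (⟨hx.1.le, hx.2⟩ : x ∈ Icc (1 / 2 : ℝ) (7 / 6))) (by simp [hτ])
    · have : 0 ≤ 9 ^ k * M₀ := by positivity
      rw [abs_of_nonneg (by norm_num)]
      nlinarith
  -- horizontal segments at height `±T`
  have hhigh : ∀ T : ℝ, 1 ≤ T → ∀ τ : ℝ, |τ| = T →
      ‖∫ x in (1 / 2 : ℝ)..(7 / 6), Φ (x + τ * Complex.I)‖ ≤ 3 ^ k * D / T := by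
    intro T hT τ hτ
    have hT0 : 0 < T := by linarith
    refine (intervalIntegral.norm_integral_le_of_norm_le_const (C := 3 ^ k * D / T) ?_).trans ?_
    · intro x hx
      rw [uIoc_of_le (by norm_num)] at hx
      set s : ℂ := x + τ * Complex.I with hs
      have hsT : T ≤ ‖s‖ := by
        rw [← hτ]; simpa [hs] using Complex.abs_im_le_norm s
      have hz : ‖riemannZeta s‖ ≤ 3 * ‖s‖ :=
        norm_riemannZeta_le (by simpa [hs] using hx.1.le) (by simpa [hs, hτ] using hT)
      have hDs := hD s (by
        simp only [hs]; simpa using abs_le.mpr ⟨by linarith [hx.1], by linarith [hx.2]⟩)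
      simp only [hΦ, norm_mul, norm_pow]
      rw [le_div_iff₀ hT0]
      calc ‖riemannZeta s‖ ^ k * ‖L s‖ * T ≤ (3 * ‖s‖) ^ k * ‖L s‖ * ‖s‖ := by gcongr
        _ = 3 ^ k * (‖s‖ ^ (k + 1) * ‖L s‖) := by ring
        _ ≤ 3 ^ k * D := by gcongr
    · have : 0 ≤ 3 ^ k * D / T := by positivity
      rw [abs_of_nonneg (by norm_num)]
      nlinarith
  have hcont : Continuous fun t : ℝ => ‖riemannZeta ((1 / 2 : ℝ) + t * Complex.I)‖ ^ k :=
    (continuous_riemannZeta_vertical (by norm_num)).norm.pow k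
  -- the critical line
  have hup : ∀ T : ℝ, 1 ≤ T →
      ‖∫ t in (1 : ℝ)..T, Φ ((1 / 2 : ℝ) + t * Complex.I)‖ ≤ M₁ * K := by
    intro T hT
    refine (intervalIntegral.norm_integral_le_of_norm_le hT (g := fun t => M₁ *
      (‖riemannZeta ((1 / 2 : ℝ) + t * Complex.I)‖ ^ k * t ^ (-1 - η)))
      (Eventually.of_forall fun t ht => ?_) ?_).trans ?_
    · have ht1 : 1 ≤ |t| := ht.1.le.trans (le_abs_self t)
      have := hM1 t ht1
      rw [abs_of_pos (by linarith [ht.1])] at this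
      simp only [hΦ, norm_mul, norm_pow]
      rw [mul_left_comm]
      gcongr
    · refine (continuousOn_const.mul (hcont.continuousOn.mul fun t ht => ?_)).intervalIntegrable
      rw [uIcc_of_le hT] at ht
      exact (Real.continuousAt_rpow_const t _ (Or.inl (by linarith [ht.1]))).continuousWithinAt
    · rw [intervalIntegral.integral_const_mul]
      exact mul_le_mul_of_nonneg_left (hK T hT) hM1'
  have hdown : ∀ T : ℝ, 1 ≤ T →
      ‖∫ t in (-T)..(-1), Φ ((1 / 2 : ℝ) + t * Complex.I)‖ ≤ M₁ * K := by
    intro T hT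
    rw [← intervalIntegral.integral_comp_neg
      (fun t : ℝ => Φ ((1 / 2 : ℝ) + t * Complex.I))]
    refine (intervalIntegral.norm_integral_le_of_norm_le hT (g := fun t => M₁ *
      (‖riemannZeta ((1 / 2 : ℝ) + t * Complex.I)‖ ^ k * t ^ (-1 - η)))
      (Eventually.of_forall fun t ht => ?_) ?_).trans ?_
    · have ht1 : 1 ≤ |-t| := by rw [abs_neg]; exact ht.1.le.trans (le_abs_self t)
      have := hM1 (-t) ht1
      rw [abs_neg, abs_of_pos (by linarith [ht.1])] at this
      have hconj : ((1 / 2 : ℝ) + (-t : ℝ) * Complex.I : ℂ)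
          = (starRingEnd ℂ) ((1 / 2 : ℝ) + t * Complex.I) := by
        rw [map_add, map_mul, Complex.conj_ofReal, Complex.conj_ofReal, Complex.conj_I]
        push_cast; ring
      have hz : ‖riemannZeta ((1 / 2 : ℝ) + (-t : ℝ) * Complex.I)‖
          = ‖riemannZeta ((1 / 2 : ℝ) + t * Complex.I)‖ := by
        rw [hconj, riemannZeta_conj, RCLike.norm_conj]
      simp only [hΦ, norm_mul, norm_pow]
      rw [mul_left_comm, hz]
      gcongr
    · refine (continuousOn_const.mul (hcont.continuousOn.mul fun t ht => ?_)).intervalIntegrable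
      rw [uIcc_of_le hT] at ht
      exact (Real.continuousAt_rpow_const t _ (Or.inl (by linarith [ht.1]))).continuousWithinAt
    · rw [intervalIntegral.integral_const_mul]
      exact mul_le_mul_of_nonneg_left (hK T hT) hM1'
  have hmid : ‖∫ t in (-1 : ℝ)..1, Φ ((7 / 6 : ℝ) + t * Complex.I)‖ ≤ 2 * Z * M₀ := by
    refine (intervalIntegral.norm_integral_le_of_norm_le_const (C := Z * M₀) ?_).trans ?_
    · intro t ht
      rw [uIoc_of_le (by norm_num)] at ht
      have h1 := hZ t ⟨ht.1.le, ht.2⟩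
      simp only [hΦ, norm_mul]
      refine mul_le_mul h1 (hM0 ((7 / 6 : ℝ) + t * Complex.I) ?_ ?_) (norm_nonneg _) hZ0
      · simp only [Complex.add_re, Complex.ofReal_re, Complex.re_ofReal_mul, Complex.I_re]
        norm_num
      · simpa using abs_le.mpr ⟨ht.1.le, ht.2⟩
    · norm_num; linarith
  have hΦc : Continuous fun t : ℝ => Φ ((7 / 6 : ℝ) + t * Complex.I) :=
    ((continuous_riemannZeta_vertical (by norm_num)).pow k).mul
      (hLd.continuous.comp (by fun_prop))
  have hfin : ∀ T : ℝ, 1 ≤ T → ‖∫ t in (-T)..T, Φ ((7 / 6 : ℝ) + t * Complex.I)‖ ≤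
      (2 * K + 2 * 9 ^ k + 2 * Z) * (M₀ + M₁) + 2 * (3 ^ k * D) / T := by
    intro T hT
    have hi : ∀ x y, IntervalIntegrable (fun t : ℝ => Φ ((7 / 6 : ℝ) + t * Complex.I)) volume x y :=
      fun x y => hΦc.intervalIntegrable x y
    rw [← intervalIntegral.integral_add_adjacent_intervals (hi (-T) 1) (hi 1 T),
      ← intervalIntegral.integral_add_adjacent_intervals (hi (-T) (-1)) (hi (-1) 1)]
    have e1 := norm_integral_right_le_of_differentiableOn (Φ := Φ) (σ₀ := 1 / 2) (σ₁ := 7 / 6)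
      (by norm_num) hT fun s _ hs => hΦd s (hs.1.trans (le_abs_self _))
    have e2 := norm_integral_right_le_of_differentiableOn (Φ := Φ) (σ₀ := 1 / 2) (σ₁ := 7 / 6)
      (t₀ := -T) (t₁ := -1) (by norm_num) (by linarith) fun s _ hs =>
        hΦd s (by rw [← abs_neg]; exact (by linarith [hs.2] : 1 ≤ -s.im).trans (le_abs_self _))
    have a1 := hlow 1 (by simp)
    have a2 := hlow (-1) (by simp)
    have b1 := hhigh T hT T (abs_of_pos (by linarith))
    have b2 := hhigh T hT (-T) (by rw [abs_neg]; exact abs_of_pos (by linarith))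
    refine (norm_add₃_le).trans ?_
    have c1 := hup T hT
    have c2 := hdown T hT
    have hx : 0 ≤ 2 * K * M₀ + 2 * 9 ^ k * M₁ + 2 * Z * M₁ := by positivity
    have hy : 2 * (3 ^ k * D) / T = 3 ^ k * D / T + 3 ^ k * D / T := by ring
    rw [hy]
    linarith
  -- the integrand is integrable, but this need not be proved: otherwise the integral is `0`
  by_cases hI : Integrable fun t : ℝ => Φ ((7 / 6 : ℝ) + t * Complex.I)
  · have hlim := (intervalIntegral_tendsto_integral hI tendsto_neg_atTop_atBot tendsto_id).norm
    have hrhs : Tendsto (fun T : ℝ => (2 * K + 2 * 9 ^ k + 2 * Z) * (M₀ + M₁) +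
        2 * (3 ^ k * D) / T) atTop (𝓝 ((2 * K + 2 * 9 ^ k + 2 * Z) * (M₀ + M₁) + 0)) :=
      tendsto_const_nhds.add (tendsto_const_nhds.div_atTop tendsto_id)
    rw [add_zero] at hrhs
    refine le_of_tendsto_of_tendsto hlim hrhs ?_
    filter_upwards [eventually_ge_atTop 1] with T hT using hfin T hT
  · rw [integral_undef hI, norm_zero]
    positivity

end Contour

/-! ### The smoothed weight and its transform -/

section SmoothTransition

/-- The first two derivatives of `Real.smoothTransition` vanish off `[0, 1]`, hence are bounded. -/
lemma exists_smoothTransition_hasDerivAt :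
    ∃ (τ₁ τ₂ : ℝ → ℝ) (T : ℝ), 0 ≤ T ∧
      (∀ x, HasDerivAt Real.smoothTransition (τ₁ x) x) ∧ (∀ x, HasDerivAt τ₁ (τ₂ x) x) ∧
      Continuous τ₁ ∧ (∀ x, 0 ≤ τ₁ x) ∧ (∀ x, τ₁ x ≤ T) ∧ ∀ x, |τ₂ x| ≤ T := by
  have h0 : ContDiff ℝ ∞ Real.smoothTransition := Real.smoothTransition.contDiff
  have h1 := (contDiff_infty_iff_deriv.mp h0).2
  have h2 := (contDiff_infty_iff_deriv.mp h1).2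
  have hout : ∀ x, x ∉ Icc (0 : ℝ) 1 → deriv Real.smoothTransition x = 0 := by
    intro x hx
    rw [mem_Icc, not_and_or, not_le, not_le] at hx
    rcases hx with hx | hx
    · have : Real.smoothTransition =ᶠ[𝓝 x] fun _ => 0 := by
        filter_upwards [Iio_mem_nhds hx] with y hy
        exact Real.smoothTransition.zero_of_nonpos (le_of_lt hy)
      rw [this.deriv_eq, deriv_const]
    · have : Real.smoothTransition =ᶠ[𝓝 x] fun _ => 1 := by
        filter_upwards [Ioi_mem_nhds hx] with y hy
        exact Real.smoothTransition.one_of_one_le (le_of_lt hy)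
      rw [this.deriv_eq, deriv_const]
  have hcs : HasCompactSupport (deriv Real.smoothTransition) :=
    HasCompactSupport.intro isCompact_Icc hout
  obtain ⟨T₁, hT₁⟩ := hcs.exists_bound_of_continuous h1.continuous
  obtain ⟨T₂, hT₂⟩ := hcs.deriv.exists_bound_of_continuous h2.continuous
  have hT0 : 0 ≤ T₁ := (norm_nonneg _).trans (hT₁ 0)
  refine ⟨_, _, max T₁ T₂, hT0.trans (le_max_left _ _),
    fun x => (h0.differentiable (by simp) x).hasDerivAt,
    fun x => (h1.differentiable (by simp) x).hasDerivAt, h1.continuous,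
    fun x => Real.smoothTransition.monotone.deriv_nonneg,
    fun x => (le_abs_self _).trans ((hT₁ x).trans (le_max_left _ _)),
    fun x => (hT₂ x).trans (le_max_right _ _)⟩

end SmoothTransition

section Weight

/-- In the variable `u = log x`, a smooth cutoff equal to `1` for `A ≤ x ≤ B` and to `0` for
`x ≤ A - 1/2` and for `x ≥ B + 1`. For integers `A ≤ B` it picks out exactly the integers in
`[A, B]`. -/
noncomputable def logCutoff (A B u : ℝ) : ℝ :=
  Real.smoothTransition (2 * Real.exp u - 2 * A + 1) -
    Real.smoothTransition (2 * Real.exp u - 2 * B - 1)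

/-- The phase `3π x^{2/3} + π/8` twisted by `x^{it}`, in the variable `u = log x`. -/
noncomputable def logPhase (t u : ℝ) : ℝ :=
  3 * Real.pi * Real.exp (2 / 3 * u) + Real.pi / 8 + t * u

/-- The smoothed summand `x^{-1/6} e^{i(3π x^{2/3} + π/8)}` in the variable `u = log x`. -/
noncomputable def logWeight (A B u : ℝ) : ℂ :=
  logCutoff A B u * Complex.exp (((-(u / 6) : ℝ) : ℂ) + Complex.I * logPhase 0 u)

variable {A B a b : ℝ}

lemma contDiff_logCutoff (A B : ℝ) : ContDiff ℝ ∞ (logCutoff A B) := by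
  unfold logCutoff
  have h : ContDiff ℝ ∞ Real.smoothTransition := Real.smoothTransition.contDiff
  exact (h.comp (by fun_prop)).sub (h.comp (by fun_prop))

lemma contDiff_logPhase (t : ℝ) : ContDiff ℝ ∞ (logPhase t) := by
  unfold logPhase
  fun_prop

lemma contDiff_logWeight (A B : ℝ) : ContDiff ℝ ∞ (logWeight A B) := by
  unfold logWeight
  have h1 : ContDiff ℝ ∞ fun u : ℝ => (logCutoff A B u : ℂ) :=
    Complex.ofRealCLM.contDiff.comp (contDiff_logCutoff A B)
  have h2 : ContDiff ℝ ∞ fun u : ℝ => (logPhase 0 u : ℂ) :=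
    Complex.ofRealCLM.contDiff.comp (contDiff_logPhase 0)
  have h3 : ContDiff ℝ ∞ fun u : ℝ => ((-(u / 6) : ℝ) : ℂ) :=
    Complex.ofRealCLM.contDiff.comp (contDiff_id.div_const 6).neg
  exact h1.mul (h3.add (contDiff_const.mul h2)).cexp

lemma logCutoff_eq_zero_of_le (hAB : A ≤ B) {u : ℝ} (hu : Real.exp u ≤ A - 1 / 2) :
    logCutoff A B u = 0 := by
  rw [logCutoff, Real.smoothTransition.zero_of_nonpos (by linarith),
    Real.smoothTransition.zero_of_nonpos (by linarith), sub_zero]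

lemma logCutoff_eq_zero_of_ge (hAB : A ≤ B) {u : ℝ} (hu : B + 1 ≤ Real.exp u) :
    logCutoff A B u = 0 := by
  rw [logCutoff, Real.smoothTransition.one_of_one_le (by linarith),
    Real.smoothTransition.one_of_one_le (by linarith), sub_self]

lemma logCutoff_eq_one {u : ℝ} (hA : A ≤ Real.exp u) (hB : Real.exp u ≤ B) :
    logCutoff A B u = 1 := by
  rw [logCutoff, Real.smoothTransition.one_of_one_le (by linarith),
    Real.smoothTransition.zero_of_nonpos (by linarith), sub_zero]

lemma logCutoff_nonneg (hAB : A ≤ B) (u : ℝ) : 0 ≤ logCutoff A B u :=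
  sub_nonneg.mpr (Real.smoothTransition.monotone (by linarith))

lemma logCutoff_le_one (A B u : ℝ) : logCutoff A B u ≤ 1 := by
  unfold logCutoff
  linarith [Real.smoothTransition.le_one (2 * Real.exp u - 2 * A + 1),
    Real.smoothTransition.nonneg (2 * Real.exp u - 2 * B - 1)]

lemma logWeight_eq_zero (hAB : A ≤ B) (ha : Real.exp a = A - 1 / 2) (hb : Real.exp b = B + 1)
    {u : ℝ} (hu : u ∉ Icc a b) : logWeight A B u = 0 := by
  have : logCutoff A B u = 0 := by
    rw [mem_Icc, not_and_or, not_le, not_le] at hu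
    rcases hu with hu | hu
    · exact logCutoff_eq_zero_of_le hAB (ha ▸ (Real.exp_le_exp.mpr hu.le))
    · exact logCutoff_eq_zero_of_ge hAB (hb ▸ (Real.exp_le_exp.mpr hu.le))
  rw [logWeight, this, Complex.ofReal_zero, zero_mul]

lemma hasCompactSupport_logWeight (hAB : A ≤ B) (ha : Real.exp a = A - 1 / 2)
    (hb : Real.exp b = B + 1) : HasCompactSupport (logWeight A B) :=
  HasCompactSupport.intro isCompact_Icc fun _ hu => logWeight_eq_zero hAB ha hb hu

lemma hasDerivAt_exp_mul (c u : ℝ) :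
    HasDerivAt (fun v => Real.exp (c * v)) (c * Real.exp (c * u)) u := by
  have := ((hasDerivAt_id u).const_mul c).exp
  simpa [mul_comm] using this

lemma hasDerivAt_logPhase (t u : ℝ) :
    HasDerivAt (logPhase t) (2 * Real.pi * Real.exp (2 / 3 * u) + t) u := by
  have := (((hasDerivAt_exp_mul (2 / 3) u).const_mul (3 * Real.pi)).add_const (Real.pi / 8)).add
    ((hasDerivAt_id u).const_mul t)
  exact HasDerivAt.congr_deriv (f := logPhase t) this (by ring)

lemma hasDerivAt_logPhase' (t u : ℝ) :
    HasDerivAt (fun u => 2 * Real.pi * Real.exp (2 / 3 * u) + t)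
      (4 / 3 * Real.pi * Real.exp (2 / 3 * u)) u := by
  have := ((hasDerivAt_exp_mul (2 / 3) u).const_mul (2 * Real.pi)).add_const t
  exact this.congr_deriv (by ring)

lemma norm_integral_exp_logPhase_le (t : ℝ) {c : ℝ} (hac : a ≤ c) :
    ‖∫ u in a..c, Complex.exp (Complex.I * logPhase t u)‖ ≤ 6 / Real.exp (a / 3) := by
  have h := norm_integral_exp_I_le_of_deriv2_ge (ψ := logPhase t) (lam := Real.exp (2 / 3 * a)) hac
    (hasDerivAt_logPhase t) (hasDerivAt_logPhase' t) (by fun_prop) (Real.exp_pos _) (by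
      intro u hu
      have h1 : Real.exp (2 / 3 * a) ≤ Real.exp (2 / 3 * u) :=
        Real.exp_le_exp.mpr (by linarith [hu.1])
      have h2 := Real.pi_gt_three
      have h3 := Real.exp_pos (2 / 3 * u)
      nlinarith)
  rwa [show √(Real.exp (2 / 3 * a)) = Real.exp (a / 3) by
    rw [Real.sqrt_eq_iff_mul_self_eq (Real.exp_pos _).le (Real.exp_pos _).le, ← Real.exp_add]
    congr 1; ring] at h

lemma norm_integral_exp_logPhase_le_div {t c : ℝ} (hac : a ≤ c)
    (ht : 4 * Real.pi * Real.exp (2 / 3 * c) ≤ |t|) :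
    ‖∫ u in a..c, Complex.exp (Complex.I * logPhase t u)‖ ≤ 4 / |t| := by
  have hpi := Real.pi_pos
  have htpos : 0 < |t| := lt_of_lt_of_le (by positivity) ht
  have hle : ∀ u ∈ Icc a c, 2 * Real.pi * Real.exp (2 / 3 * u) ≤ |t| / 2 := by
    intro u hu
    have h1 : Real.exp (2 / 3 * u) ≤ Real.exp (2 / 3 * c) :=
      Real.exp_le_exp.mpr (by linarith [hu.2])
    have := mul_le_mul_of_nonneg_left h1 (by positivity : 0 ≤ 2 * Real.pi)
    linarith
  have h4 : 2 / (|t| / 2) = 4 / |t| := by field_simp; norm_num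
  rw [← h4]
  rcases le_total 0 t with h | h
  · rw [abs_of_nonneg h] at *
    refine norm_integral_exp_I_le_of_deriv_ge hac (hasDerivAt_logPhase t) (hasDerivAt_logPhase' t)
      (by fun_prop) (by linarith) (fun u _ => ?_) (fun u _ => by positivity)
    have : 0 ≤ 2 * Real.pi * Real.exp (2 / 3 * u) := by positivity
    linarith
  · rw [abs_of_nonpos h] at *
    refine norm_integral_exp_I_le_of_deriv_le hac (hasDerivAt_logPhase t) (hasDerivAt_logPhase' t)
      (by fun_prop) (by linarith) (fun u hu => ?_) (fun u _ => by positivity)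
    linarith [hle u hu]

/-- The amplitude `x^{σ-1/6} W(x)` has total variation at most `3 (B+1)^{σ-1/6}`, so the transform
is controlled by the unweighted oscillatory integrals. -/
lemma norm_bilateralLaplace_logWeight_le (hAB : A ≤ B) (ha : Real.exp a = A - 1 / 2)
    (hb : Real.exp b = B + 1) {σ t M : ℝ} (hσ : 1 / 6 ≤ σ)
    (hM : ∀ c ∈ Icc a b, ‖∫ u in a..c, Complex.exp (Complex.I * logPhase t u)‖ ≤ M) :
    ‖bilateralLaplace (logWeight A B) (σ + t * Complex.I)‖ ≤
      M * (3 * Real.exp ((σ - 1 / 6) * b)) := by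
  obtain ⟨τ₁, -, -, -, hτ, -, hτc, hτ0, -, -⟩ := exists_smoothTransition_hasDerivAt
  have hab : a ≤ b := Real.exp_le_exp.mp (by rw [ha, hb]; linarith)
  have hM0 : 0 ≤ M := (norm_nonneg _).trans (hM a (left_mem_Icc.mpr hab))
  set ρ := σ - 1 / 6 with hρ
  have hρ0 : 0 ≤ ρ := by rw [hρ]; linarith
  set p : ℝ → ℝ := fun u => 2 * Real.exp u - 2 * A + 1 with hp
  set q : ℝ → ℝ := fun u => 2 * Real.exp u - 2 * B - 1 with hq
  have hpd : ∀ u, HasDerivAt p (2 * Real.exp u) u := fun u =>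
    (((Real.hasDerivAt_exp u).const_mul 2).sub_const _).add_const _
  have hqd : ∀ u, HasDerivAt q (2 * Real.exp u) u := fun u =>
    (((Real.hasDerivAt_exp u).const_mul 2).sub_const _).sub_const _
  have hpc : Continuous p := by fun_prop
  have hqc : Continuous q := by fun_prop
  set P' : ℝ → ℝ := fun u => τ₁ (p u) * (2 * Real.exp u) with hP'
  set Q' : ℝ → ℝ := fun u => τ₁ (q u) * (2 * Real.exp u) with hQ'
  have hPd : ∀ u, HasDerivAt (fun u => Real.smoothTransition (p u)) (P' u) u := fun u =>
    (hτ (p u)).comp u (hpd u)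
  have hQd : ∀ u, HasDerivAt (fun u => Real.smoothTransition (q u)) (Q' u) u := fun u =>
    (hτ (q u)).comp u (hqd u)
  have hP'c : Continuous P' := by fun_prop
  have hQ'c : Continuous Q' := by fun_prop
  have hP0 : ∀ u, 0 ≤ P' u := fun u => mul_nonneg (hτ0 _) (by positivity)
  have hQ0 : ∀ u, 0 ≤ Q' u := fun u => mul_nonneg (hτ0 _) (by positivity)
  have hWd : ∀ u, HasDerivAt (logCutoff A B) (P' u - Q' u) u := fun u => (hPd u).sub (hQd u)
  have hWc : Continuous (logCutoff A B) := (contDiff_logCutoff A B).continuous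
  have hwd : ∀ u, HasDerivAt (fun u => Real.exp (ρ * u) * logCutoff A B u)
      (ρ * Real.exp (ρ * u) * logCutoff A B u + Real.exp (ρ * u) * (P' u - Q' u)) u := fun u =>
    (hasDerivAt_exp_mul ρ u).mul (hWd u)
  have hκ : Continuous fun u => Complex.exp (Complex.I * logPhase t u) := by
    have := (contDiff_logPhase t).continuous
    fun_prop
  have key := norm_integral_mul_le_of_forall_norm_integral_le hab hκ hwd (by fun_prop)
    (by rw [logCutoff_eq_zero_of_ge hAB hb.ge, mul_zero]) hM
  have hL : bilateralLaplace (logWeight A B) (σ + t * Complex.I) =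
      ∫ u in a..b, ((Real.exp (ρ * u) * logCutoff A B u : ℝ) : ℂ) *
        Complex.exp (Complex.I * logPhase t u) := by
    rw [intervalIntegral.integral_of_le hab, ← integral_Icc_eq_integral_Ioc, bilateralLaplace,
      ← setIntegral_eq_integral_of_forall_compl_eq_zero (s := Icc a b)]
    · refine setIntegral_congr_fun measurableSet_Icc fun u _ => ?_
      simp only [logWeight]
      rw [mul_left_comm, ← Complex.exp_add]
      push_cast
      rw [mul_comm (Complex.exp (ρ * u)), mul_assoc, ← Complex.exp_add]
      congr 2
      simp only [hρ, logPhase]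
      push_cast
      ring
    · intro u hu
      rw [logWeight_eq_zero hAB ha hb hu, mul_zero]
  rw [hL]
  refine key.trans (mul_le_mul_of_nonneg_left ?_ hM0)
  have hbound : ∫ u in a..b, |ρ * Real.exp (ρ * u) * logCutoff A B u +
      Real.exp (ρ * u) * (P' u - Q' u)| ≤
      ∫ u in a..b, (ρ * Real.exp (ρ * u) + Real.exp (ρ * b) * (P' u + Q' u)) := by
    refine intervalIntegral.integral_mono_on hab
      ((by fun_prop : Continuous _).intervalIntegrable _ _)
      ((by fun_prop : Continuous _).intervalIntegrable _ _) fun u hu => ?_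
    refine (abs_add_le _ _).trans (add_le_add ?_ ?_)
    · rw [abs_of_nonneg (mul_nonneg (by positivity) (logCutoff_nonneg hAB u))]
      exact mul_le_of_le_one_right (by positivity) (logCutoff_le_one A B u)
    · rw [abs_mul, abs_of_pos (Real.exp_pos _)]
      refine mul_le_mul (Real.exp_le_exp.mpr (mul_le_mul_of_nonneg_left hu.2 hρ0)) ?_
        (abs_nonneg _) (Real.exp_pos _).le
      exact abs_le.mpr ⟨by linarith [hP0 u, hQ0 u], by linarith [hP0 u, hQ0 u]⟩
  have hftc := intervalIntegral.integral_eq_sub_of_hasDerivAt (a := a) (b := b)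
    (f := fun u => Real.exp (ρ * u) + Real.exp (ρ * b) *
      (Real.smoothTransition (p u) + Real.smoothTransition (q u)))
    (fun u _ => (hasDerivAt_exp_mul ρ u).add (((hPd u).add (hQd u)).const_mul _))
    ((by fun_prop : Continuous fun u => ρ * Real.exp (ρ * u) +
      Real.exp (ρ * b) * (P' u + Q' u)).intervalIntegrable _ _)
  refine hbound.trans (hftc.le.trans ?_)
  have e1 := Real.smoothTransition.le_one (p b)
  have e2 := Real.smoothTransition.le_one (q b)
  have e3 := Real.smoothTransition.nonneg (p a)
  have e4 := Real.smoothTransition.nonneg (q a)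
  have e5 := Real.exp_pos (ρ * b)
  have e6 := Real.exp_pos (ρ * a)
  have e7 : Real.exp (ρ * b) * (Real.smoothTransition (p b) + Real.smoothTransition (q b)) ≤
    Real.exp (ρ * b) * 2 := mul_le_mul_of_nonneg_left (by linarith) e5.le
  have e8 : 0 ≤ Real.exp (ρ * b) * (Real.smoothTransition (p a) + Real.smoothTransition (q a)) := by
    positivity
  linarith

/-- Two integrations by parts give a crude bound with quadratic decay in `t`. -/
lemma exists_norm_bilateralLaplace_logWeight_le_div_sq :
    ∃ K : ℝ, 0 ≤ K ∧ ∀ A B a b : ℝ, 1 ≤ A → A ≤ B → Real.exp a = A - 1 / 2 →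
      Real.exp b = B + 1 → ∀ t : ℝ, t ≠ 0 →
        ‖bilateralLaplace (logWeight A B) ((1 / 2 : ℝ) + t * Complex.I)‖ ≤
          K * Real.exp b ^ 4 / t ^ 2 := by
  obtain ⟨τ₁, τ₂, T, hT, hτ, hτ', hτc, hτ0, hτ1, hτ2⟩ := exists_smoothTransition_hasDerivAt
  refine ⟨(76 * T + 69) * 2, by positivity, fun A B a b hA hAB ha hb t ht => ?_⟩
  have hab : a ≤ b := Real.exp_le_exp.mp (by rw [ha, hb]; linarith)
  set Y := Real.exp b with hY
  have hY1 : 1 ≤ Y := by rw [hb]; linarith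
  have hb0 : 0 ≤ b := by rw [← Real.one_le_exp_iff]; exact hY1
  set p : ℝ → ℝ := fun u => 2 * Real.exp u - 2 * A + 1 with hp
  set q : ℝ → ℝ := fun u => 2 * Real.exp u - 2 * B - 1 with hq
  have hpd : ∀ u, HasDerivAt p (2 * Real.exp u) u := fun u =>
    (((Real.hasDerivAt_exp u).const_mul 2).sub_const _).add_const _
  have hqd : ∀ u, HasDerivAt q (2 * Real.exp u) u := fun u =>
    (((Real.hasDerivAt_exp u).const_mul 2).sub_const _).sub_const _
  set W₁ : ℝ → ℝ := fun u => (τ₁ (p u) - τ₁ (q u)) * (2 * Real.exp u) with hW₁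
  set W₂ : ℝ → ℝ := fun u => (τ₂ (p u) * (2 * Real.exp u) - τ₂ (q u) * (2 * Real.exp u)) *
    (2 * Real.exp u) + (τ₁ (p u) - τ₁ (q u)) * (2 * Real.exp u) with hW₂
  have hWd : ∀ u, HasDerivAt (logCutoff A B) (W₁ u) u := fun u => by
    have := ((hτ (p u)).comp u (hpd u)).sub ((hτ (q u)).comp u (hqd u))
    rw [← sub_mul] at this
    exact this
  have hW₁d : ∀ u, HasDerivAt W₁ (W₂ u) u := fun u =>
    (((hτ' (p u)).comp u (hpd u)).sub ((hτ' (q u)).comp u (hqd u))).mul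
      ((Real.hasDerivAt_exp u).const_mul 2)
  set r : ℝ → ℂ := fun u => ((-(1 / 6) : ℝ) : ℂ) +
    Complex.I * ((2 * Real.pi * Real.exp (2 / 3 * u) + 0 : ℝ) : ℂ) with hr
  set r₁ : ℝ → ℂ := fun u =>
    Complex.I * ((4 / 3 * Real.pi * Real.exp (2 / 3 * u) : ℝ) : ℂ) with hr₁
  have hrd : ∀ u, HasDerivAt r (r₁ u) u := fun u =>
    ((hasDerivAt_logPhase' 0 u).ofReal_comp.const_mul _).const_add _
  set e : ℝ → ℂ := fun u =>
    Complex.exp (((-(u / 6) : ℝ) : ℂ) + Complex.I * logPhase 0 u) with he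
  have hed : ∀ u, HasDerivAt e (e u * r u) u := fun u => by
    have h1 : HasDerivAt (fun u : ℝ => -(u / 6)) (-(1 / 6)) u := ((hasDerivAt_id u).div_const 6).neg
    exact (h1.ofReal_comp.add ((hasDerivAt_logPhase 0 u).ofReal_comp.const_mul Complex.I)).cexp
  set W := logCutoff A B with hW
  set g₁ : ℝ → ℂ := fun u => (W₁ u : ℂ) * e u + (W u : ℂ) * (e u * r u) with hg₁
  have hgd : ∀ u, HasDerivAt (logWeight A B) (g₁ u) u := fun u =>
    (hWd u).ofReal_comp.mul (hed u)
  set g₂ : ℝ → ℂ := fun u => ((W₂ u : ℂ) * e u + (W₁ u : ℂ) * (e u * r u)) +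
    ((W₁ u : ℂ) * (e u * r u) + (W u : ℂ) * (e u * r u * r u + e u * r₁ u)) with hg₂
  have hg₁d : ∀ u, HasDerivAt g₁ (g₂ u) u := fun u =>
    ((hW₁d u).ofReal_comp.mul (hed u)).add ((hWd u).ofReal_comp.mul ((hed u).mul (hrd u)))
  have hdg : deriv (logWeight A B) = g₁ := funext fun u => (hgd u).deriv
  have hddg : deriv (deriv (logWeight A B)) = g₂ := by
    rw [hdg]; exact funext fun u => (hg₁d u).deriv
  have hsm := contDiff_logWeight A B
  have hcs := hasCompactSupport_logWeight hAB ha hb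
  set s : ℂ := (1 / 2 : ℝ) + t * Complex.I with hs
  have hLs : bilateralLaplace g₂ s = s ^ 2 * bilateralLaplace (logWeight A B) s := by
    rw [← hddg, bilateralLaplace_deriv ((contDiff_infty_iff_deriv.mp hsm).2.of_le
      (by exact_mod_cast le_top)) hcs.deriv, bilateralLaplace_deriv (hsm.of_le
      (by exact_mod_cast le_top)) hcs]
    ring
  have hg₂0 : ∀ u, u ∉ Icc a b → g₂ u = 0 := by
    intro u hu
    rw [← hddg]
    by_contra hne
    have h1 : tsupport (logWeight A B) ⊆ Icc a b :=
      closure_minimal (fun v hv => by_contra fun hv' => hv (logWeight_eq_zero hAB ha hb hv'))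
        isClosed_Icc
    exact hu (h1 ((tsupport_deriv_subset (f := logWeight A B)) (support_deriv_subset hne)))
  have hbd : ∀ u ∈ Icc a b, ‖Complex.exp (s * u) * g₂ u‖ ≤ (76 * T + 69) * Y ^ 3 := by
    intro u hu
    have hpi := Real.pi_lt_d2
    have hpi0 := Real.pi_pos
    have x1 : Real.exp u ≤ Y := Real.exp_le_exp.mpr hu.2
    have x0 := Real.exp_pos u
    have x2 : Real.exp (2 / 3 * u) ≤ Y := Real.exp_le_exp.mpr (by linarith [hu.2])
    have x3 : Real.exp (u / 3) ≤ Y := Real.exp_le_exp.mpr (by linarith [hu.2])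
    have d1 : |τ₁ (p u) - τ₁ (q u)| ≤ T :=
      abs_le.mpr ⟨by linarith [hτ0 (p u), hτ1 (q u)], by linarith [hτ0 (q u), hτ1 (p u)]⟩
    have d2 : |τ₂ (p u) - τ₂ (q u)| ≤ 2 * T :=
      (abs_sub _ _).trans (by linarith [hτ2 (p u), hτ2 (q u)])
    have w1 : ‖(W₁ u : ℂ)‖ ≤ 2 * T * Y := by
      rw [Complex.norm_real, Real.norm_eq_abs, abs_mul,
        abs_of_pos (by positivity : 0 < 2 * Real.exp u)]
      calc |τ₁ (p u) - τ₁ (q u)| * (2 * Real.exp u) ≤ T * (2 * Y) := by gcongr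
        _ = 2 * T * Y := by ring
    have w2 : ‖(W₂ u : ℂ)‖ ≤ 10 * T * Y ^ 2 := by
      rw [Complex.norm_real, Real.norm_eq_abs, hW₂]
      refine (abs_add_le _ _).trans ?_
      have h2 : 0 < 2 * Real.exp u := by positivity
      rw [← sub_mul, abs_mul, abs_mul, abs_mul _ (2 * Real.exp u), abs_of_pos h2]
      calc |τ₂ (p u) - τ₂ (q u)| * (2 * Real.exp u) * (2 * Real.exp u) +
            |τ₁ (p u) - τ₁ (q u)| * (2 * Real.exp u)
          ≤ 2 * T * (2 * Y) * (2 * Y) + T * (2 * Y) := by gcongr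
        _ ≤ 10 * T * Y ^ 2 := by 
          have h3 : 0 ≤ T * Y * (Y - 1) :=
            mul_nonneg (mul_nonneg hT (by linarith)) (by linarith)
          linarith
    have w0 : ‖(W u : ℂ)‖ ≤ 1 := by
      rw [Complex.norm_real, Real.norm_of_nonneg (logCutoff_nonneg hAB u)]
      exact logCutoff_le_one A B u
    have r0 : ‖r u‖ ≤ 8 * Y := by
      refine (norm_add_le _ _).trans ?_
      rw [norm_mul, Complex.norm_I, one_mul, Complex.norm_real, Complex.norm_real, norm_neg,
        Real.norm_of_nonneg (by norm_num), Real.norm_of_nonneg (by positivity)]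
      have : 2 * Real.pi * Real.exp (2 / 3 * u) ≤ 2 * 3.15 * Y := by gcongr
      linarith
    have r1 : ‖r₁ u‖ ≤ 5 * Y := by
      rw [hr₁, norm_mul, Complex.norm_I, one_mul, Complex.norm_real,
        Real.norm_of_nonneg (by positivity)]
      have : 4 / 3 * Real.pi * Real.exp (2 / 3 * u) ≤ 4 / 3 * 3.15 * Y := by gcongr
      linarith
    have e0 : ‖Complex.exp (s * u)‖ * ‖e u‖ ≤ Y := by
      rw [← norm_mul, he, ← Complex.exp_add, Complex.norm_exp]
      refine le_of_eq_of_le ?_ x3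
      congr 1
      simp [hs]
      ring
    have hfac : Complex.exp (s * u) * g₂ u = Complex.exp (s * u) * e u * ((W₂ u : ℂ) +
        2 * ((W₁ u : ℂ) * r u) + (W u : ℂ) * (r u * r u + r₁ u)) := by
      rw [hg₂]; ring
    rw [hfac, norm_mul, norm_mul]
    have hsum : ‖(W₂ u : ℂ) + 2 * ((W₁ u : ℂ) * r u) + (W u : ℂ) * (r u * r u + r₁ u)‖ ≤
        10 * T * Y ^ 2 + 2 * (2 * T * Y * (8 * Y)) + 1 * (8 * Y * (8 * Y) + 5 * Y) := by
      refine norm_add₃_le.trans ?_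
      rw [norm_mul, norm_mul, norm_mul, Complex.norm_ofNat]
      have : ‖r u * r u + r₁ u‖ ≤ 8 * Y * (8 * Y) + 5 * Y := by
        refine (norm_add_le _ _).trans ?_
        rw [norm_mul]
        gcongr
      gcongr
    calc ‖Complex.exp (s * u)‖ * ‖e u‖ * ‖(W₂ u : ℂ) + 2 * ((W₁ u : ℂ) * r u) +
          (W u : ℂ) * (r u * r u + r₁ u)‖
        ≤ Y * (10 * T * Y ^ 2 + 2 * (2 * T * Y * (8 * Y)) + 1 * (8 * Y * (8 * Y) + 5 * Y)) := by
          gcongr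
      _ ≤ (76 * T + 69) * Y ^ 3 := by
          have : 0 ≤ T * Y ^ 3 := by positivity
          nlinarith [mul_nonneg (by positivity : 0 ≤ Y ^ 2) (by linarith : 0 ≤ Y - 1)]
  have hnorm : ‖bilateralLaplace g₂ s‖ ≤ (76 * T + 69) * Y ^ 3 * (b - a) := by
    rw [bilateralLaplace, ← setIntegral_eq_integral_of_forall_compl_eq_zero (s := Icc a b)
      (fun u hu => by rw [hg₂0 u hu, mul_zero])]
    refine (norm_setIntegral_le_of_norm_le_const (by simp) hbd).trans ?_
    rw [Real.volume_real_Icc_of_le hab]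
  have hlen : b - a ≤ 2 * Y := by
    have h1 := Real.add_one_le_exp (b - a)
    rw [Real.exp_sub, ha] at h1
    have h2 : Real.exp b / (A - 1 / 2) ≤ 2 * Y := by
      rw [div_le_iff₀ (by linarith)]
      nlinarith
    linarith
  rw [hLs, norm_mul, norm_pow] at hnorm
  have hst : t ^ 2 ≤ ‖s‖ ^ 2 := by
    rw [← sq_abs]
    gcongr
    simpa [hs] using Complex.abs_im_le_norm s
  have ht2 : 0 < t ^ 2 := by positivity
  rw [le_div_iff₀ ht2]
  calc ‖bilateralLaplace (logWeight A B) s‖ * t ^ 2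
      ≤ ‖s‖ ^ 2 * ‖bilateralLaplace (logWeight A B) s‖ := by
        rw [mul_comm]; gcongr
    _ ≤ (76 * T + 69) * Y ^ 3 * (2 * Y) := hnorm.trans (by gcongr)
    _ = (76 * T + 69) * 2 * Y ^ 4 := by ring

end Weight

/-! ### Bounds in terms of `N` -/

section Estimates

/-- Interpolation of the three bounds for the transform on the critical line into a single one
with integrable decay. -/
lemma le_mul_rpow_of_le_of_le_div_of_le_div_sq {N x F K η : ℝ} (hN : 1 ≤ N) (hx : 1 ≤ x)
    (hK : 0 ≤ K) (hη : 0 < η) (hη1 : η ≤ 1) (h1 : F ≤ 108)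
    (h2 : 40 * N ^ (2 / 3 : ℝ) ≤ x → F ≤ 36 * N ^ (1 / 3 : ℝ) / x) (h3 : F ≤ K * N ^ 4 / x ^ 2) :
    F ≤ (172836 + K) * N ^ (2 / 3 + 4 * η) * x ^ (-1 - η) := by
  have hN0 : 0 < N := by linarith
  have hx0 : 0 < x := by linarith
  have hxp : x ^ (-1 - η) = (x ^ (1 + η))⁻¹ := by
    rw [← Real.rpow_neg hx0.le]; congr 1; ring
  have hxq : 0 < x ^ (1 + η) := by positivity
  rw [hxp, ← div_eq_mul_inv, le_div_iff₀ hxq]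
  have hP : 0 < N ^ (2 / 3 + 4 * η) := by positivity
  have hKP : 0 ≤ K * N ^ (2 / 3 + 4 * η) := by positivity
  -- the constant is `108 · 40² + 36 + K`, one term for each of the ranges of `x` below
  rcases le_total x (40 * N ^ (2 / 3 : ℝ)) with hx1 | hx1
  · have e1 : x ^ (1 + η) ≤ 1600 * N ^ (2 / 3 + 4 * η) := by
      calc x ^ (1 + η) ≤ (40 * N ^ (2 / 3 : ℝ)) ^ (1 + η) := by gcongr
        _ = 40 ^ (1 + η) * N ^ (2 / 3 * (1 + η)) := by
            rw [Real.mul_rpow (by norm_num) (by positivity), ← Real.rpow_mul hN0.le]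
        _ ≤ 40 ^ (2 : ℝ) * N ^ (2 / 3 + 4 * η) := by
            refine mul_le_mul (Real.rpow_le_rpow_of_exponent_le (by norm_num) (by linarith))
              (Real.rpow_le_rpow_of_exponent_le hN (by linarith)) (by positivity) (by positivity)
        _ = 1600 * N ^ (2 / 3 + 4 * η) := by norm_num
    nlinarith
  rcases le_total x (N ^ 4) with hx2 | hx2
  · have e2 : x ^ η ≤ N ^ (4 * η) := by
      rw [Real.rpow_mul hN0.le]
      have : N ^ (4 : ℝ) = N ^ 4 := by norm_cast
      rw [this]
      gcongr
    have e3 : N ^ (1 / 3 : ℝ) * N ^ (4 * η) ≤ N ^ (2 / 3 + 4 * η) := by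
      rw [← Real.rpow_add hN0]
      exact Real.rpow_le_rpow_of_exponent_le hN (by linarith)
    have e4 : F * x ^ (1 + η) ≤ 36 * (N ^ (1 / 3 : ℝ) * N ^ (4 * η)) := by
      calc F * x ^ (1 + η) ≤ 36 * N ^ (1 / 3 : ℝ) / x * x ^ (1 + η) := by
            gcongr; exact h2 hx1
        _ = 36 * (N ^ (1 / 3 : ℝ) * x ^ η) := by
            rw [Real.rpow_add hx0, Real.rpow_one]; field_simp
        _ ≤ _ := by gcongr
    linarith
  · have e2 : x ^ (η - 1) ≤ (N ^ 4) ^ (η - 1) :=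
      Real.rpow_le_rpow_of_nonpos (by positivity) hx2 (by linarith)
    have e3 : N ^ 4 * (N ^ 4) ^ (η - 1) ≤ N ^ (2 / 3 + 4 * η) := by
      have : N ^ 4 = N ^ (4 : ℝ) := by norm_cast
      rw [this, ← Real.rpow_mul hN0.le, ← Real.rpow_add hN0]
      exact Real.rpow_le_rpow_of_exponent_le hN (by linarith)
    have e4 : F * x ^ (1 + η) ≤ K * (N ^ 4 * (N ^ 4) ^ (η - 1)) := by
      calc F * x ^ (1 + η) ≤ K * N ^ 4 / x ^ 2 * x ^ (1 + η) := by gcongr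
        _ = K * (N ^ 4 * x ^ (η - 1)) := by
            rw [show (1 + η) = 2 + (η - 1) by ring, Real.rpow_add hx0]
            have : x ^ (2 : ℝ) = x ^ 2 := by norm_cast
            rw [this]; field_simp
        _ ≤ _ := by gcongr
    have e5 := mul_le_mul_of_nonneg_left e3 hK
    linarith

/-- The transform of the cutoff to `[N, 2N]`: it is `O(N^{2/3})` uniformly for
`1/2 ≤ Re s ≤ 7/6`, and `O(N^{2/3+4η} |t|^{-1-η})` on the critical line. -/
lemma exists_norm_bilateralLaplace_logWeight_bounds :
    ∃ K : ℝ, 0 ≤ K ∧ ∀ N : ℝ, 1 ≤ N → ∀ A B a b : ℝ, A ≤ B → N ≤ A → B ≤ 2 * N →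
      Real.exp a = A - 1 / 2 → Real.exp b = B + 1 →
      (∀ σ ∈ Icc (1 / 2 : ℝ) (7 / 6), ∀ t : ℝ,
        ‖bilateralLaplace (logWeight A B) (σ + t * Complex.I)‖ ≤ 108 * N ^ (2 / 3 : ℝ)) ∧
      ∀ η : ℝ, 0 < η → η ≤ 1 → ∀ t : ℝ, 1 ≤ |t| →
        ‖bilateralLaplace (logWeight A B) ((1 / 2 : ℝ) + t * Complex.I)‖ ≤
          K * N ^ (2 / 3 + 4 * η) * |t| ^ (-1 - η) := by
  obtain ⟨K, hK0, hK⟩ := exists_norm_bilateralLaplace_logWeight_le_div_sq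
  refine ⟨172836 + K * 81, by positivity, fun N hN A B a b hAB hNA hBN ha hb => ?_⟩
  have hN0 : 0 < N := by linarith
  have hab : a ≤ b := Real.exp_le_exp.mp (by rw [ha, hb]; linarith)
  have hb0 : 0 ≤ b := by rw [← Real.one_le_exp_iff, hb]; linarith
  set R := N ^ (1 / 3 : ℝ) with hR
  have hR0 : 0 < R := by positivity
  have hR3 : R ^ 3 = N := by
    rw [hR, ← Real.rpow_natCast, ← Real.rpow_mul hN0.le]; norm_num
  have hR2 : N ^ (2 / 3 : ℝ) = R ^ 2 := by
    rw [hR, ← Real.rpow_natCast, ← Real.rpow_mul hN0.le]; norm_num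
  have hcube : ∀ v : ℝ, Real.exp (v / 3) ^ 3 = Real.exp v := fun v => by
    rw [← Real.exp_nat_mul]; congr 1; push_cast; ring
  have ha3 : R / 2 ≤ Real.exp (a / 3) := by
    refine le_of_pow_le_pow_left₀ three_ne_zero (Real.exp_pos _).le ?_
    rw [hcube, ha, div_pow, hR3]
    linarith
  have hb3 : Real.exp (b / 3) ≤ 3 * R := by
    refine le_of_pow_le_pow_left₀ three_ne_zero (by positivity) ?_
    rw [hcube, hb, mul_pow, hR3]
    linarith
  have hsecond : ∀ t c, a ≤ c →
      ‖∫ u in a..c, Complex.exp (Complex.I * logPhase t u)‖ ≤ 12 / R := by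
    intro t c hac
    refine (norm_integral_exp_logPhase_le t hac).trans ?_
    rw [div_le_div_iff₀ (Real.exp_pos _) hR0]
    linarith
  constructor
  · intro σ hσ t
    refine (norm_bilateralLaplace_logWeight_le hAB ha hb (by linarith [hσ.1])
      fun c hc => hsecond t c hc.1).trans ?_
    have h1 : Real.exp ((σ - 1 / 6) * b) ≤ 3 * N := by
      have : Real.exp ((σ - 1 / 6) * b) ≤ Real.exp b :=
        Real.exp_le_exp.mpr (by nlinarith [hσ.2])
      linarith
    calc 12 / R * (3 * Real.exp ((σ - 1 / 6) * b)) ≤ 12 / R * (3 * (3 * N)) := by gcongr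
      _ = 108 * N ^ (2 / 3 : ℝ) := by
          rw [hR2, ← hR3]; field_simp; norm_num
  · intro η hη hη1 t ht
    have ht0 : 0 < |t| := by linarith
    have hhalf : Real.exp ((1 / 2 - 1 / 6) * b) ≤ 3 * R := by
      rwa [show (1 / 2 - 1 / 6 : ℝ) * b = b / 3 by ring]
    refine le_mul_rpow_of_le_of_le_div_of_le_div_sq hN ht (by positivity) hη hη1 ?_ ?_ ?_
    · refine (norm_bilateralLaplace_logWeight_le hAB ha hb (by norm_num)
        fun c hc => hsecond t c hc.1).trans ?_
      calc 12 / R * (3 * Real.exp ((1 / 2 - 1 / 6) * b)) ≤ 12 / R * (3 * (3 * R)) := by gcongr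
        _ = 108 := by field_simp; norm_num
    · intro htN
      have hthr : 4 * Real.pi * Real.exp (2 / 3 * b) ≤ |t| := by
        refine le_trans ?_ htN
        have h1 : Real.exp (2 / 3 * b) ≤ 3 * R ^ 2 := by
          refine le_of_pow_le_pow_left₀ three_ne_zero (by positivity) ?_
          have : Real.exp (2 / 3 * b) ^ 3 = Real.exp b ^ 2 := by
            rw [← Real.exp_nat_mul, ← Real.exp_nat_mul]; congr 1; push_cast; ring
          rw [this, hb, mul_pow, ← pow_mul, mul_comm 2 3, pow_mul, hR3]
          nlinarith
        have h2 := Real.pi_lt_d2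
        calc 4 * Real.pi * Real.exp (2 / 3 * b) ≤ 4 * 3.15 * (3 * R ^ 2) := by gcongr
          _ ≤ 40 * N ^ (2 / 3 : ℝ) := by rw [hR2]; nlinarith [sq_nonneg R]
      refine (norm_bilateralLaplace_logWeight_le hAB ha hb (M := 4 / |t|) (by norm_num)
        fun c hc => norm_integral_exp_logPhase_le_div hc.1 (le_trans ?_ hthr)).trans ?_
      · gcongr
        exact hc.2
      · calc 4 / |t| * (3 * Real.exp ((1 / 2 - 1 / 6) * b)) ≤ 4 / |t| * (3 * (3 * R)) := by gcongr
          _ = 36 * R / |t| := by ring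
    · refine (hK A B a b (by linarith) hAB ha hb t (abs_pos.mp ht0)).trans ?_
      rw [sq_abs]
      have hpow : Real.exp b ^ 4 ≤ 81 * N ^ 4 := by
        have : Real.exp b ^ 4 ≤ (3 * N) ^ 4 := by
          gcongr
          linarith
        linarith [(by ring : (3 * N) ^ 4 = 81 * N ^ 4)]
      rw [mul_assoc K]
      gcongr

/-- At integers the smoothed weight is the summand itself, with no smoothing error. -/
lemma logWeight_log_natCast_re {A B n : ℕ} (hA : 1 ≤ A) (hn : n ∈ Finset.Icc A B) :
    (logWeight A B (Real.log n)).re = (n : ℝ) ^ (-(1 / 6 : ℝ)) *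
      Real.cos (3 * Real.pi * (n : ℝ) ^ (2 / 3 : ℝ) + Real.pi / 8) := by
  obtain ⟨h1, h2⟩ := Finset.mem_Icc.mp hn
  have hn0 : (0 : ℝ) < n := by exact_mod_cast hA.trans h1
  have hexp : Real.exp (Real.log n) = n := Real.exp_log hn0
  rw [logWeight, logCutoff_eq_one (by rw [hexp]; exact_mod_cast h1)
    (by rw [hexp]; exact_mod_cast h2), Complex.ofReal_one, one_mul, Complex.exp_re]
  have e1 : Real.exp (2 / 3 * Real.log n) = (n : ℝ) ^ (2 / 3 : ℝ) := by
    rw [Real.rpow_def_of_pos hn0, mul_comm]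
  have e2 : Real.exp (-(Real.log n / 6)) = (n : ℝ) ^ (-(1 / 6 : ℝ)) := by
    rw [Real.rpow_def_of_pos hn0]; congr 1; ring
  rw [Complex.add_re, Complex.add_im, Complex.I_mul_re, Complex.I_mul_im, Complex.ofReal_re,
    Complex.ofReal_im, Complex.ofReal_re, Complex.ofReal_im, neg_zero, add_zero, zero_add, e2,
    logPhase, e1, zero_mul, add_zero]

lemma logWeight_log_natCast_eq_zero {A B n : ℕ} (hAB : A ≤ B) (hn0 : n ≠ 0)
    (hn : n ∉ Finset.Icc A B) : logWeight A B (Real.log n) = 0 := by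
  have hpos : (0 : ℝ) < n := by exact_mod_cast Nat.pos_of_ne_zero hn0
  have hexp : Real.exp (Real.log n) = n := Real.exp_log hpos
  have hAB' : (A : ℝ) ≤ B := by exact_mod_cast hAB
  have : logCutoff A B (Real.log n) = 0 := by
    rw [Finset.mem_Icc, not_and_or, not_le, not_le] at hn
    rcases hn with hn | hn
    · refine logCutoff_eq_zero_of_le hAB' ?_
      have : (n : ℝ) + 1 ≤ A := by exact_mod_cast hn
      rw [hexp]; linarith
    · refine logCutoff_eq_zero_of_ge hAB' ?_
      rw [hexp]; exact_mod_cast hn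
  rw [logWeight, this, Complex.ofReal_zero, zero_mul]

end Estimates

end

theorem theorem3 (k : ℕ) (hk : 1 ≤ k) (hmoment : ZetaMomentBound k) :
    ∀ ε : ℝ, 0 < ε → ∃ C : ℝ, ∀ N : ℝ, 1 ≤ N →
      |∑ n ∈ Finset.Icc ⌈N⌉₊ ⌊2 * N⌋₊,
          (kFoldDivisor k n : ℝ) * (n : ℝ) ^ (-(1 / 6 : ℝ)) *
            Real.cos (3 * Real.pi * (n : ℝ) ^ (2 / 3 : ℝ) + Real.pi / 8)|
        ≤ C * N ^ (2 / 3 + ε) := by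
  intro ε hε
  set η := min (ε / 4) 1 with hη
  have hη0 : 0 < η := lt_min (by linarith) one_pos
  have hη4 : 4 * η ≤ ε := by linarith [min_le_left (ε / 4) 1]
  obtain ⟨C, hC0, hC⟩ := exists_norm_integral_zeta_pow_mul_bilateralLaplace_le hmoment hη0
  obtain ⟨K, hK0, hK⟩ := exists_norm_bilateralLaplace_logWeight_bounds
  refine ⟨C * (108 + K), fun N hN => ?_⟩
  set A := ⌈N⌉₊ with hA
  set B := ⌊2 * N⌋₊ with hB
  have hNA : N ≤ A := Nat.le_ceil N
  have hBN : (B : ℝ) ≤ 2 * N := Nat.floor_le (by linarith)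
  have hAB : A ≤ B := Nat.le_floor (by linarith [Nat.ceil_lt_add_one (by linarith : 0 ≤ N)])
  have hA1 : 1 ≤ A := by exact_mod_cast hN.trans hNA
  have hAB' : (A : ℝ) ≤ B := by exact_mod_cast hAB
  have ha : Real.exp (Real.log ((A : ℝ) - 1 / 2)) = (A : ℝ) - 1 / 2 := Real.exp_log (by linarith)
  have hb : Real.exp (Real.log ((B : ℝ) + 1)) = (B : ℝ) + 1 := Real.exp_log (by linarith)
  obtain ⟨hM0, hM1⟩ := hK N hN A B _ _ hAB' hNA hBN ha hb
  have hsm := contDiff_logWeight A B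
  have hcs := hasCompactSupport_logWeight hAB' ha hb
  -- the bound for `|Im s| ≤ 1` holds at every height
  have hint := hC (logWeight A B) _ _ hsm hcs
    (fun s hs _ => by simpa using hM0 s.re hs s.im) (hM1 η hη0 (min_le_right _ _))
  have hsum := hasSum_kFoldDivisor_mul k hsm hcs (σ := 7 / 6) (by norm_num) (by norm_num)
  have hfin := hasSum_sum_of_ne_finset_zero (L := SummationFilter.unconditional ℕ) (s := Finset.Icc A B)
    (f := fun n : ℕ => 2 * Real.pi * ((kFoldDivisor k n : ℂ) * logWeight A B (Real.log n)))
    (fun n hn => by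
      rcases eq_or_ne n 0 with rfl | hn0
      · simp [kFoldDivisor]
      · rw [logWeight_log_natCast_eq_zero hAB hn0 hn, mul_zero, mul_zero])
  rw [← hfin.unique hsum, ← Finset.mul_sum, norm_mul] at hint
  have hpi : (1 : ℝ) ≤ ‖(2 * Real.pi : ℂ)‖ := by
    rw [norm_mul, Complex.norm_real, Complex.norm_ofNat, Real.norm_of_nonneg Real.pi_pos.le]
    linarith [Real.pi_gt_three]
  have hre : ∑ n ∈ Finset.Icc A B, (kFoldDivisor k n : ℝ) * (n : ℝ) ^ (-(1 / 6 : ℝ)) *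
      Real.cos (3 * Real.pi * (n : ℝ) ^ (2 / 3 : ℝ) + Real.pi / 8) =
      (∑ n ∈ Finset.Icc A B, (kFoldDivisor k n : ℂ) * logWeight A B (Real.log n)).re := by
    rw [Complex.re_sum]
    refine Finset.sum_congr rfl fun n hn => ?_
    rw [← Complex.ofReal_natCast, Complex.re_ofReal_mul, logWeight_log_natCast_re hA1 hn, mul_assoc]
  rw [hre]
  refine (Complex.abs_re_le_norm _).trans ((le_mul_of_one_le_left (norm_nonneg _) hpi).trans
    (hint.trans ?_))
  have h1 : N ^ (2 / 3 : ℝ) ≤ N ^ (2 / 3 + ε) :=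
    Real.rpow_le_rpow_of_exponent_le hN (by linarith)
  have h2 : N ^ (2 / 3 + 4 * η) ≤ N ^ (2 / 3 + ε) :=
    Real.rpow_le_rpow_of_exponent_le hN (by linarith)
  calc C * (108 * N ^ (2 / 3 : ℝ) + K * N ^ (2 / 3 + 4 * η))
      ≤ C * (108 * N ^ (2 / 3 + ε) + K * N ^ (2 / 3 + ε)) := by gcongr
    _ = C * (108 + K) * N ^ (2 / 3 + ε) := by ring
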